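/- Let $M$ be a complex manifold and let $V$ be a polarized complex variation of Hodge structures of weight $w$ on $M$: a local system of finite-dimensional complex vector spaces with flat connection $\nabla$, a decomposition $V=\bigoplus_p V^{p,w-p}$ into $C^\infty$ complex subbundles such that $\nabla$ maps sections of $V^{p,w-p}$ to $\mathcal A^{1,0}(V^{p-1,w-p+1})\oplus\mathcal A^1(V^{p,w-p})\oplus\mathcal A^{0,1}(V^{p+1,w-p-1})$, and a $\nabla$-flat hermitian form $h$ on $V$ for which the $V^{p,w-p}$ are mutually orthogonal and $(-1)^p h$ is positive definite on $V^{p,w-p}$. The Hodge metric $h_C$ is the positive definite hermitian metric that equals $(-1)^p h$ on $V^{p,w-p}$ and makes the $V^{p,w-p}$ mutually orthogonal. Write $\nabla=\sigma+D+\sigma^*$, where $\sigma$, $D$, $\sigma^*$ change the degree $p$ by $-1$, $0$, $+1$ respectively. Then $\bar\partial:=D^{0,1}$ is the $\bar\partial$-operator of the holomorphic bundle $V_{\rm Hdg}=\bigoplus_p F^p/F^{p+1}$, $F^p=\bigoplus_{r\ge p}V^{r,w-r}$, identified with $V$ as a $C^\infty$ bundle, and $\sigma$ is its Higgs field. A graded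 Higgs subbundle of $V$ is a family of subspaces $W=\bigoplus_p W^{p,w-p}\subset V$ with $W^{p,w-p}=W\cap V^{p,w-p}$ a $C^\infty$ subbundle of $V^{p,w-p}$ for every $p$, which is a holomorphic subbundle of $V_{\rm Hdg}$ (that is, $\bar\partial$ preserves $W$) and which is preserved by $\sigma$. Its first Chern form with respect to the Hodge metric is $$\gamma_1(W,h_C)=\frac{i}{2\pi}\,\mathrm{Tr}(F_W),$$ where $F_W$ is the curvature of the Chern connection of $(W,\bar\partial|_W,h_C|_W)$, i.e. of the unique connection on $W$ that is compatible with $h_C|_W$ and has $(0,1)$-part $\bar\partial|_W$. Let $W$ be a graded Higgs subbundle of $V$ and let $W^\perp$ be its orthogonal complement with respect to $h_C$. Then the first Chern form of $W$ is well defined and: 1. $\gamma_1(W,h_C)$ is a real $(1,1)$-form which is negative semi-definite: $\gamma_1(W,h_C)(v,Jv)\le 0$ for every real tangent vector $v$, where $J$ is the complex structure. 2. $\gamma_1(W,h_C)$ vanishes identically on $M$ if and only if $W^\perp$ is also a (holomorphic) graded Higgs subbundle of $V$. 3. In this case $V=W\oplus W^\perp$ is a splitting of polarized complex variations of Hodge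 structures: $W$ and $W^\perp$ are preserved by $\nabla$, they are polarized complex variations for the decompositions and the form $h$ induced from $V$, they are orthogonal for $h$, and $V^{p,w-p}=W^{p,w-p}\oplus (W^\perp)^{p,w-p}$ for every $p$. -/

import Mathlib

open scoped Manifold ContDiff
open Bundle

/-!
Conventions.  `M` is a complex manifold modelled on the finite-dimensional complex space `E`
(`IsManifold 𝓘(ℂ, E) ω M`).  The same atlas makes it a real smooth manifold (model `𝓘(ℝ, E)`), and
the real tangent space at `x` is `E`, read in the preferred chart at `x`; since the charts are
holomorphic, the complex structure `J` of the real tangent space is multiplication by `i` on `E`.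
-/

namespace CVHS

noncomputable section

section Basic

variable {E : Type*} [NormedAddCommGroup E] [NormedSpace ℂ E]
  {M : Type*} [TopologicalSpace M] [ChartedSpace E M]

/-- The real differential of a vector-valued function on `M`. -/
def realDeriv {G : Type*} [NormedAddCommGroup G] [NormedSpace ℂ G] (f : M → G) (x : M) :
    E →L[ℝ] G :=
  mfderiv 𝓘(ℝ, E) 𝓘(ℝ, G) f x

/-- The value at `y` of the coordinate vector field with constant coefficients `v` in the preferred
chart at `x₀`, i.e. the push-forward of the constant field `v` by the inverse of that chart.
Two such fields (with the same `x₀`) commute near `x₀`. -/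
def coordField (x₀ : M) (v : E) (y : M) : E :=
  (mfderiv 𝓘(ℝ, E) 𝓘(ℝ, E) (extChartAt 𝓘(ℝ, E) x₀).symm (extChartAt 𝓘(ℝ, E) x₀ y) : E →L[ℝ] E) v

/-- The `(1,0)`-part of a real-linear form on the tangent space:
`α^{1,0}(v) = (α(v) - i α(i v)) / 2`. -/
def part10 {U : Type*} [AddCommGroup U] [Module ℂ U] (α : E →ₗ[ℝ] U) (v : E) : U :=
  (1 / 2 : ℂ) • (α v - Complex.I • α (Complex.I • v))

/-- The `(0,1)`-part of a real-linear form on the tangent space: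
`α^{0,1}(v) = (α(v) + i α(i v)) / 2`. -/
def part01 {U : Type*} [AddCommGroup U] [Module ℂ U] (α : E →ₗ[ℝ] U) (v : E) : U :=
  (1 / 2 : ℂ) • (α v + Complex.I • α (Complex.I • v))

/-- `γ` is a real 2-form of type `(1,1)` which is negative semi-definite:
`γ(v, J v) ≤ 0` for every real tangent vector `v`.  (The form `i dz ∧ dz̄` is positive for this
sign convention.) -/
def IsNegSemidefOneOneForm (γ : M → E →ₗ[ℝ] E →ₗ[ℝ] ℂ) : Prop :=
  ∀ (x : M) (v w : E),
    (γ x v w).im = 0 ∧ γ x w v = -γ x v w ∧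
    γ x (Complex.I • v) (Complex.I • w) = γ x v w ∧
    (γ x v (Complex.I • v)).re ≤ 0

end Basic

section Flat

variable {E : Type*} [NormedAddCommGroup E] [NormedSpace ℂ E]
  {M : Type*} [TopologicalSpace M] [ChartedSpace E M]
  (F : Type*) [NormedAddCommGroup F] [NormedSpace ℂ F]
  {V : M → Type*} [∀ x, AddCommGroup (V x)] [∀ x, Module ℂ (V x)] [∀ x, TopologicalSpace (V x)]
  [TopologicalSpace (TotalSpace F V)] [FiberBundle F V] [VectorBundle ℂ F V]

variable (V) in
/-- The complex vector bundle `V` is a *local system*: the transition functions between the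
trivializations of its atlas are locally constant. -/
def IsLocalSystem : Prop :=
  ∀ (e e' : Trivialization F (π F V)) [MemTrivializationAtlas e] [MemTrivializationAtlas e'],
    ∀ x ∈ e.baseSet ∩ e'.baseSet,
      ∀ᶠ y in nhds x, e.coordChangeL ℂ e' y = e.coordChangeL ℂ e' x

/-- The section `s` of `V` is `C^∞` (over `ℝ`) on a neighbourhood of `x`, and there takes its values
in the family of subspaces `L`. -/
def IsSmoothSectionNear (L : ∀ x, Submodule ℂ (V x)) (s : ∀ x, V x) (x : M) : Prop :=
  ∀ᶠ y in nhds x, s y ∈ L y ∧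
    ContMDiffAt 𝓘(ℝ, E) (𝓘(ℝ, E).prod 𝓘(ℝ, F)) ∞ (fun z => TotalSpace.mk' F z (s z)) y

/-- The family of subspaces `L` is a `C^∞` complex subbundle of `V`: it has `C^∞` local frames. -/
def IsSmoothSubbundle (L : ∀ x, Submodule ℂ (V x)) : Prop :=
  ∀ x : M, ∃ (r : ℕ) (s : Fin r → ∀ y, V y),
    (∀ i, IsSmoothSectionNear (E := E) F L (s i) x) ∧
    ∀ᶠ y in nhds x, LinearIndependent ℂ (fun i => s i y) ∧
      Submodule.span ℂ (Set.range fun i => s i y) = L y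

/-- The canonical flat connection `∇` of a local system: differentiate the components in a flat
trivialization.  `flatConn F s x v` is `(∇_v s)(x)`. -/
def flatConn (s : ∀ x, V x) (x : M) : E →ₗ[ℝ] V x :=
  (((trivializationAt F V x).symmₗ ℂ x).restrictScalars ℝ) ∘ₗ
    (realDeriv (fun y => (trivializationAt F V x ⟨y, s y⟩).2) x : E →L[ℝ] F).toLinearMap

/-- The family of subspaces `L`, with the decomposition `L = ⨁_p H p` and with the restriction of
the sesquilinear form `h`, is a polarized complex variation of Hodge structures inside the local
system `V`.  Here `H p` stands for `V^{p,w-p}`, where `w` is the weight.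
(For `L = V`, this says that `V` itself is such a variation.)  -/
structure IsPolarizedVariation (L : ∀ x, Submodule ℂ (V x)) (H : ℤ → ∀ x, Submodule ℂ (V x))
    (h : ∀ x, V x →ₗ[ℂ] V x →ₗ⋆[ℂ] ℂ) : Prop where
  /-- `L` is a `C^∞` subbundle of `V` ... -/
  subbundle : IsSmoothSubbundle (E := E) F L
  /-- ... which is preserved by `∇`, i.e. a sub-local system. -/
  parallel : ∀ (x : M) (s : ∀ y, V y), IsSmoothSectionNear (E := E) F L s x →
    ∀ v : E, flatConn F s x v ∈ L x
  /-- The `H p` are `C^∞` subbundles, and `L` is their direct sum. -/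
  hodge_subbundle : ∀ p, IsSmoothSubbundle (E := E) F (H p)
  hodge_indep : ∀ x, iSupIndep fun p => H p x
  hodge_sum : ∀ x, ⨆ p, H p x = L x
  /-- Transversality: `∇` maps sections of `H p` to
  `A^{1,0}(H (p-1)) ⊕ A^1(H p) ⊕ A^{0,1}(H (p+1))`. -/
  transversal : ∀ (p : ℤ) (x : M) (s : ∀ y, V y), IsSmoothSectionNear (E := E) F (H p) s x →
    ∀ v : E, part10 (flatConn F s x) v ∈ H (p - 1) x ⊔ H p x ∧
      part01 (flatConn F s x) v ∈ H p x ⊔ H (p + 1) x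
  /-- `h` is a hermitian form on `L` ... -/
  hermitian : ∀ x, ∀ u ∈ L x, ∀ t ∈ L x, h x u t = (starRingEnd ℂ) (h x t u)
  /-- ... of class `C^∞` ... -/
  form_smooth : ∀ (x : M) (s t : ∀ y, V y), IsSmoothSectionNear (E := E) F L s x →
    IsSmoothSectionNear (E := E) F L t x →
    ContMDiffAt 𝓘(ℝ, E) 𝓘(ℝ, ℂ) ∞ (fun y => h y (s y) (t y)) x
  /-- ... preserved by `∇` ... -/
  form_flat : ∀ (x : M) (s t : ∀ y, V y), IsSmoothSectionNear (E := E) F L s x →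
    IsSmoothSectionNear (E := E) F L t x → ∀ v : E,
    realDeriv (fun y => h y (s y) (t y)) x v =
      h x (flatConn F s x v) (t x) + h x (s x) (flatConn F t x v)
  /-- ... and satisfying the two Riemann bilinear relations: the `H p` are mutually orthogonal and
  `(-1)^p h` is positive definite on `H p`. -/
  orthogonal : ∀ x p q, p ≠ q → ∀ u ∈ H p x, ∀ t ∈ H q x, h x u t = 0
  positive : ∀ x p, ∀ u ∈ H p x, u ≠ 0 → 0 < (((-1 : ℂ) ^ p) * h x u u).re

end Flat

section Hodge

variable {E : Type*} [NormedAddCommGroup E] [NormedSpace ℂ E]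
  {M : Type*} [TopologicalSpace M] [ChartedSpace E M]
  (F : Type*) [NormedAddCommGroup F] [NormedSpace ℂ F]
  {V : M → Type*} [∀ x, AddCommGroup (V x)] [∀ x, Module ℂ (V x)] [∀ x, TopologicalSpace (V x)]
  [TopologicalSpace (TotalSpace F V)] [FiberBundle F V] [VectorBundle ℂ F V]
  (H : ℤ → ∀ x, Submodule ℂ (V x)) (h : ∀ x, V x →ₗ[ℂ] V x →ₗ⋆[ℂ] ℂ)

open Classical in
/-- The projection of `V = ⨁_p H p` onto its summand `H p` (and `0` if the sum is not direct). -/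
def hodgeProj (p : ℤ) (x : M) : V x →ₗ[ℂ] V x :=
  if hc : IsCompl (H p x) (⨆ q, ⨆ (_ : q ≠ p), H q x) then Submodule.projection _ _ hc else 0

/-- The operator equal to `(-1)^p` on `H p`. -/
def hodgeSign (x : M) : V x →ₗ[ℂ] V x :=
  ∑ᶠ p : ℤ, ((-1 : ℂ) ^ p) • hodgeProj H p x

/-- The Hodge metric `h_C`: the `H p` are orthogonal and `h_C = (-1)^p h` on `H p`. -/
def hodgeMetric (x : M) : V x →ₗ[ℂ] V x →ₗ⋆[ℂ] ℂ :=
  (h x) ∘ₗ hodgeSign H x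

/-- The component `D` of `∇ = σ + D + σ*` that preserves the degree, a connection on the Hodge
bundle `V_Hdg = ⨁_p F^p / F^{p+1}`, where `F^p / F^{p+1}` is identified with `H p`.
Its `(0,1)`-part is the `∂̄`-operator of `V_Hdg`: on a section of `H p` it is `∇^{0,1}`
modulo `F^{p+1}`. -/
def hodgeConn (s : ∀ x, V x) (x : M) : E →ₗ[ℝ] V x :=
  ∑ᶠ p : ℤ, ((hodgeProj H p x).restrictScalars ℝ) ∘ₗ
    flatConn (E := E) F (fun y => hodgeProj H p y (s y)) x

/-- The Higgs field `σ`: the component of `∇ = σ + D + σ*` that lowers the degree by one.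
`higgs F H s x v` is `(σ_v s)(x)`. -/
def higgs (s : ∀ x, V x) (x : M) : E →ₗ[ℝ] V x :=
  ∑ᶠ p : ℤ, ((hodgeProj H (p - 1) x).restrictScalars ℝ) ∘ₗ
    flatConn (E := E) F (fun y => hodgeProj H p y (s y)) x

/-- `W ⊆ V_Hdg` is a (holomorphic) graded Higgs subbundle: `W = ⨁_p W^p` with `W^p = W ∩ H p`
a `C^∞` subbundle of `H p`; the `∂̄`-operator of `V_Hdg` preserves (the sections of) `W`, i.e. `W`
is a holomorphic subbundle; and the Higgs field preserves `W`. -/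
structure IsGradedHiggsSubbundle (W : ∀ x, Submodule ℂ (V x)) : Prop where
  graded : ∀ x, ⨆ p, W x ⊓ H p x = W x
  subbundle : ∀ p, IsSmoothSubbundle (E := E) F (fun x => W x ⊓ H p x)
  holomorphic : ∀ (x : M) (s : ∀ y, V y), IsSmoothSectionNear (E := E) F W s x →
    ∀ v : E, part01 (hodgeConn F H s x) v ∈ W x
  higgs_mem : ∀ (x : M) (s : ∀ y, V y), IsSmoothSectionNear (E := E) F W s x →
    ∀ v : E, higgs F H s x v ∈ W x

/-- The orthogonal complement of `W` with respect to the Hodge metric. -/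
def perp (W : ∀ x, Submodule ℂ (V x)) (x : M) : Submodule ℂ (V x) :=
  (W x).orthogonalBilin (hodgeMetric H h x)

/-- `D` is the *Chern connection* of the subbundle `W` with the holomorphic structure of `V_Hdg` and
the Hodge metric: a `C^∞` complex connection on `W` which is compatible with the metric and whose
`(0,1)`-part is the `∂̄`-operator.  `D s x v` is `(D_v s)(x)`; only the values on sections `s` that
near `x` are `C^∞` sections of `W` matter. -/
structure IsChernConnection (W : ∀ x, Submodule ℂ (V x))
    (D : (∀ x, V x) → ∀ x, E →ₗ[ℝ] V x) : Prop where
  /-- The covariant derivative along a coordinate field is again a `C^∞` section of `W`. -/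
  smooth : ∀ (x : M) (s : ∀ y, V y), IsSmoothSectionNear (E := E) F W s x →
    ∀ v : E, IsSmoothSectionNear (E := E) F W (fun y => D s y (coordField x v y)) x
  add : ∀ (x : M) (s t : ∀ y, V y), IsSmoothSectionNear (E := E) F W s x →
    IsSmoothSectionNear (E := E) F W t x →
    D (fun y => s y + t y) x = D s x + D t x
  leibniz : ∀ (x : M) (f : M → ℂ) (s : ∀ y, V y),
    (∀ᶠ y in nhds x, ContMDiffAt 𝓘(ℝ, E) 𝓘(ℝ, ℂ) ∞ f y) →
    IsSmoothSectionNear (E := E) F W s x → ∀ v : E,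
    D (fun y => f y • s y) x v = (realDeriv f x v : ℂ) • s x + f x • D s x v
  metric : ∀ (x : M) (s t : ∀ y, V y), IsSmoothSectionNear (E := E) F W s x →
    IsSmoothSectionNear (E := E) F W t x → ∀ v : E,
    realDeriv (fun y => hodgeMetric H h y (s y) (t y)) x v =
      hodgeMetric H h x (D s x v) (t x) + hodgeMetric H h x (s x) (D t x v)
  dbar : ∀ (x : M) (s : ∀ y, V y), IsSmoothSectionNear (E := E) F W s x →
    ∀ v : E, part01 (D s x) v = part01 (hodgeConn F H s x) v

/-- `Ω` is the *curvature* of the connection `D` on `W`, an `End W`-valued 2-form: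
`Ω(v, w) s = D_v D_w s - D_w D_v s` for `C^∞` sections `s` of `W` and for coordinate fields
(whose bracket vanishes) extending `v` and `w`. -/
def IsCurvature (W : ∀ x, Submodule ℂ (V x)) (D : (∀ x, V x) → ∀ x, E →ₗ[ℝ] V x)
    (Ω : ∀ x, E →ₗ[ℝ] E →ₗ[ℝ] Module.End ℂ (W x)) : Prop :=
  ∀ (x : M) (s : ∀ y, V y), IsSmoothSectionNear (E := E) F W s x →
    ∀ (v w : E) (u : W x), (u : V x) = s x →
      (Ω x v w u : V x) =
        D (fun y => D s y (coordField x w y)) x v - D (fun y => D s y (coordField x v y)) x w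

/-- `γ` is the *first Chern form* of `W` with respect to the Hodge metric: `i / 2π` times the
trace of the curvature of the Chern connection. -/
def IsFirstChernForm (W : ∀ x, Submodule ℂ (V x)) (γ : M → E →ₗ[ℝ] E →ₗ[ℝ] ℂ) : Prop :=
  ∃ (D : (∀ x, V x) → ∀ x, E →ₗ[ℝ] V x) (Ω : ∀ x, E →ₗ[ℝ] E →ₗ[ℝ] Module.End ℂ (W x)),
    IsChernConnection F H h W D ∧ IsCurvature F W D Ω ∧
    ∀ (x : M) (v w : E),
      γ x v w = Complex.I / (2 * Real.pi) * LinearMap.trace ℂ (W x) (Ω x v w)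

/-- `V = W ⊕ W'` is a splitting of polarized complex variations: `W` and `W'`, with the induced
Hodge decompositions and polarizations, are polarized complex variations, and `V` is their direct
sum, as a local system, as a graded bundle and as a bundle with a hermitian form. -/
structure IsPolarizedSplitting (W W' : ∀ x, Submodule ℂ (V x)) : Prop where
  left : IsPolarizedVariation (E := E) F W (fun p x => W x ⊓ H p x) h
  right : IsPolarizedVariation (E := E) F W' (fun p x => W' x ⊓ H p x) h
  isCompl : ∀ x, IsCompl (W x) (W' x)
  hodge : ∀ p x, (W x ⊓ H p x) ⊔ (W' x ⊓ H p x) = H p x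
  orthogonal : ∀ x, ∀ u ∈ W x, ∀ t ∈ W' x, h x u t = 0

end Hodge

end

end CVHS

/-! The negativity is that of a subbundle whose second fundamental form has a known type, with the
ambient curvature replaced by the flatness of `∇`. Refine the Hodge decomposition to `V = ⨁_p (W^p ⊕
W'^p)` with `W' = W^⊥`, and write `∇ = D_R + θ`, where `D_R` (`diagConn`) is block diagonal and `θ`
is an endomorphism-valued form. Since `D_R` preserves `h` summand by summand, it preserves every
rescaling of `h` along the summands, in particular `h_C`. So `D_R` and `∇` both preserve `h`, and
`θ` is skew for `h`. As `W` is holomorphic, the (0,1)-part of `D_R` on `W` is `∂̄`, hence `D_R`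
restricts to the Chern connection of `W` (`isChernConnection`, `chernConnection_eq`).

Flatness of `∇` makes the curvature of `D_R` the block-diagonal part of `θ_w θ_v - θ_v θ_w`
(`IsOrthFamily.curvature`). In the trace over `W`, the products passing through `W` cancel by
cyclicity, and only the second fundamental form `N : W → W'` and its partner `N' : W' → W`, minus
the `h`-adjoint of `N`, remain (`trace_curvature`).

The degree-preserving part of `N` is of type (1,0) because `W` is holomorphic; the degree-raising
part is of type (0,1) by transversality; the degree-lowering part vanishes because `σ` preserves
`W`; there is nothing else (`component_type`). For `h_C` the partners of these two parts are minus
and plus the adjoint respectively. The change of sign compensates the change of type, so both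
contribute minus a sum of squares to `γ(v, Jv)` (`trace_secondFundamentalForm`).

Hence `γ = 0` forces `N = 0`, then `N' = 0` by adjunction, so `∇` preserves `W` and `W'`, which
gives the splitting. Conversely, if `W'` is also a graded Higgs subbundle, the type conditions on
`N` and on its adjoint contradict each other unless `N = 0` (`offBlock_eq_zero`). -/

namespace CVHS

noncomputable section

set_option linter.unusedSectionVars false

/-! ### Calculus along coordinate fields. -/

section Functions

variable {E : Type*} [NormedAddCommGroup E] [NormedSpace ℂ E]
  {M : Type*} [TopologicalSpace M] [ChartedSpace E M]

/-- A complex manifold is a real smooth manifold for the same atlas. -/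
theorem isManifold_real [IsManifold 𝓘(ℂ, E) ω M] : IsManifold 𝓘(ℝ, E) ∞ M := by
  apply isManifold_of_contDiffOn
  intro e e' he he'
  have h1 := (contDiffGroupoid ω 𝓘(ℂ, E)).mem_of_eqOnSource
    (HasGroupoid.compatible he he') (Setoid.refl _)
  rw [contDiffGroupoid, mem_groupoid_of_pregroupoid] at h1
  exact (ContDiffOn.restrict_scalars ℝ h1.1).of_le le_top

/-- `f` is smooth on a neighbourhood of `x`. -/
def SmoothNear {G : Type*} [NormedAddCommGroup G] [NormedSpace ℂ G] (f : M → G) (x : M) : Prop :=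
  ∀ᶠ y in nhds x, ContMDiffAt 𝓘(ℝ, E) 𝓘(ℝ, G) ∞ f y

/-- The derivative along a coordinate field. -/
def coordDeriv {G : Type*} [NormedAddCommGroup G] [NormedSpace ℂ G] (x : M) (v : E)
    (f : M → G) (y : M) : G :=
  realDeriv f y (coordField x v y)

variable {G : Type*} [NormedAddCommGroup G] [NormedSpace ℂ G]
  {G' : Type*} [NormedAddCommGroup G'] [NormedSpace ℂ G']

theorem SmoothNear.eventually {f : M → G} {x : M} (hf : SmoothNear (E := E) f x) :
    ∀ᶠ y in nhds x, SmoothNear (E := E) f y :=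
  eventually_eventually_nhds.2 hf

theorem SmoothNear.mdifferentiableAt {f : M → G} {x : M} (hf : SmoothNear (E := E) f x) :
    MDifferentiableAt 𝓘(ℝ, E) 𝓘(ℝ, G) f x :=
  hf.self_of_nhds.mdifferentiableAt (by simp)

theorem SmoothNear.continuousAt {f : M → G} {x : M} (hf : SmoothNear (E := E) f x) :
    ContinuousAt f x :=
  hf.self_of_nhds.continuousAt

theorem SmoothNear.congr {f g : M → G} {x : M} (hf : SmoothNear (E := E) f x)
    (h : ∀ᶠ y in nhds x, g y = f y) : SmoothNear (E := E) g x := by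
  filter_upwards [hf, eventually_eventually_nhds.2 h] with y hy hy'
  exact hy.congr_of_eventuallyEq hy'

theorem SmoothNear.comp {f : M → G} {x : M} (hf : SmoothNear (E := E) f x) {g : G → G'}
    (hg : ContDiff ℝ ∞ g) : SmoothNear (E := E) (fun y => g (f y)) x :=
  hf.mono fun _ hy => hg.contMDiff.contMDiffAt.comp _ hy

theorem smoothNear_const (c : G) (x : M) : SmoothNear (E := E) (fun _ => c) x :=
  .of_forall fun _ => contMDiffAt_const

theorem SmoothNear.add {f g : M → G} {x : M} (hf : SmoothNear (E := E) f x)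
    (hg : SmoothNear (E := E) g x) : SmoothNear (E := E) (fun y => f y + g y) x := by
  filter_upwards [hf, hg] with y h1 h2 using h1.add h2

theorem SmoothNear.prodMk {f : M → G} {g : M → G'} {x : M} (hf : SmoothNear (E := E) f x)
    (hg : SmoothNear (E := E) g x) : SmoothNear (E := E) (fun y => (f y, g y)) x := by
  filter_upwards [hf, hg] with y h1 h2 using h1.prodMk_space h2

theorem SmoothNear.smul {f : M → ℂ} {g : M → G} {x : M} (hf : SmoothNear (E := E) f x)
    (hg : SmoothNear (E := E) g x) : SmoothNear (E := E) (fun y => f y • g y) x :=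
  (hf.prodMk hg).comp (g := fun p : ℂ × G => p.1 • p.2) (by fun_prop)

theorem SmoothNear.pi {ι : Type*} [Fintype ι] {f : ι → M → ℂ} {x : M}
    (hf : ∀ i, SmoothNear (E := E) (f i) x) : SmoothNear (E := E) (fun y i => f i y) x := by
  filter_upwards [Filter.eventually_all.2 hf] with y h1
  exact contMDiffAt_pi_space.2 h1

theorem realDeriv_congr {f g : M → G} {x : M} (h : ∀ᶠ y in nhds x, f y = g y) :
    realDeriv (E := E) f x = realDeriv g x :=
  Filter.EventuallyEq.mfderiv_eq h

theorem realDeriv_add {f g : M → G} {x : M} (hf : SmoothNear (E := E) f x)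
    (hg : SmoothNear (E := E) g x) :
    realDeriv (E := E) (fun y => f y + g y) x = realDeriv f x + realDeriv g x :=
  (hf.mdifferentiableAt.hasMFDerivAt.add hg.mdifferentiableAt.hasMFDerivAt).mfderiv

theorem realDeriv_clm (L : G →L[ℝ] G') {f : M → G} {x : M}
    (hf : MDifferentiableAt 𝓘(ℝ, E) 𝓘(ℝ, G) f x) :
    realDeriv (E := E) (fun y => L (f y)) x = L ∘L realDeriv f x :=
  (L.hasMFDerivAt.comp x hf.hasMFDerivAt).mfderiv

theorem realDeriv_const (c : G) (x : M) : realDeriv (E := E) (fun _ : M => c) x = 0 :=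
  mfderiv_const

theorem realDeriv_sum {ι : Type*} (I : Finset ι) {f : ι → M → G} {x : M}
    (hf : ∀ i ∈ I, SmoothNear (E := E) (f i) x) :
    SmoothNear (E := E) (fun y => ∑ i ∈ I, f i y) x ∧
    realDeriv (E := E) (fun y => ∑ i ∈ I, f i y) x = ∑ i ∈ I, realDeriv (f i) x := by
  classical
  induction I using Finset.induction_on with
  | empty => simpa using ⟨smoothNear_const 0 x, realDeriv_const 0 x⟩
  | insert a I ha ih =>
    obtain ⟨h1, h2⟩ := ih fun i hi => hf i (Finset.mem_insert_of_mem hi)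
    have h3 := hf a (Finset.mem_insert_self a I)
    simp only [Finset.sum_insert ha]
    exact ⟨h3.add h1, by rw [realDeriv_add h3 h1, h2]⟩

theorem realDeriv_eq_fderiv {f : M → G} {x : M} (hf : MDifferentiableAt 𝓘(ℝ, E) 𝓘(ℝ, G) f x) :
    realDeriv (E := E) f x =
      fderiv ℝ (f ∘ (extChartAt 𝓘(ℝ, E) x).symm) (extChartAt 𝓘(ℝ, E) x x) := by
  have h := hf.mfderiv
  simp only [ModelWithCorners.range_eq_univ, fderivWithin_univ] at h
  exact h

variable [IsManifold 𝓘(ℝ, E) ∞ M]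

/-- At the centre of the chart the tangent space is already read in that same chart, so the
push-forward is the identity there, though not at nearby points. -/
theorem coordField_self (x : M) (v : E) : coordField x v x = v := by
  have : IsManifold 𝓘(ℝ, E) 1 M := IsManifold.of_le (n := ∞) (by simp)
  have h := mfderivWithin_range_extChartAt_symm (I := 𝓘(ℝ, E)) (x := x)
  simp only [ModelWithCorners.range_eq_univ, mfderivWithin_univ] at h
  unfold coordField
  rw [h]; rfl

/-- The chain rule in one fixed chart, also at points `y` other than its centre; this is what makes
second derivatives accessible. -/
theorem coordDeriv_eq_fderiv {x y : M} (hy : y ∈ (extChartAt 𝓘(ℝ, E) x).source) (v : E)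
    {f : M → G} (hf : MDifferentiableAt 𝓘(ℝ, E) 𝓘(ℝ, G) f y) :
    coordDeriv x v f y =
      fderiv ℝ (f ∘ (extChartAt 𝓘(ℝ, E) x).symm) (extChartAt 𝓘(ℝ, E) x y) v := by
  have : IsManifold 𝓘(ℝ, E) 1 M := IsManifold.of_le (n := ∞) (by simp)
  have h1 := mdifferentiableWithinAt_extChartAt_symm (I := 𝓘(ℝ, E))
    ((extChartAt 𝓘(ℝ, E) x).map_source hy)
  rw [ModelWithCorners.range_eq_univ, mdifferentiableWithinAt_univ] at h1
  have h2 := (extChartAt 𝓘(ℝ, E) x).left_inv hy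
  have hf' : MDifferentiableAt 𝓘(ℝ, E) 𝓘(ℝ, G) f
      ((extChartAt 𝓘(ℝ, E) x).symm (extChartAt 𝓘(ℝ, E) x y)) := by rwa [h2]
  have h3 := mfderiv_comp _ hf' h1
  rw [mfderiv_eq_fderiv] at h3
  rw [h3, h2]
  rfl

theorem smoothNear_iff_chart {f : M → G} {x : M} :
    SmoothNear (E := E) f x ↔ ∀ᶠ z in nhds (extChartAt 𝓘(ℝ, E) x x),
      ContDiffAt ℝ ∞ (f ∘ (extChartAt 𝓘(ℝ, E) x).symm) z := by
  set φ := extChartAt 𝓘(ℝ, E) x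
  have key : ∀ y ∈ φ.source, (ContMDiffAt 𝓘(ℝ, E) 𝓘(ℝ, G) ∞ f y ↔
      ContDiffAt ℝ ∞ (f ∘ φ.symm) (φ y)) := by
    intro y hy
    have h := contMDiffAt_iff_source_of_mem_source (I := 𝓘(ℝ, E)) (I' := 𝓘(ℝ, G)) (n := ∞)
      (f := f) (x := x) (x' := y) (by simpa [φ] using hy)
    rw [h, ModelWithCorners.range_eq_univ, contMDiffWithinAt_univ, contMDiffAt_iff_contDiffAt]
  constructor
  · intro h
    have h1 : Filter.Tendsto φ.symm (nhds (φ x)) (nhds x) := by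
      have := continuousAt_extChartAt_symm (I := 𝓘(ℝ, E)) x
      unfold ContinuousAt at this
      rwa [extChartAt_to_inv] at this
    filter_upwards [h1.eventually h, extChartAt_target_mem_nhds (I := 𝓘(ℝ, E)) x] with z hz hz'
    have := (key _ (φ.map_target hz')).1 hz
    rwa [φ.right_inv hz'] at this
  · intro h
    have h1 := (continuousAt_extChartAt (I := 𝓘(ℝ, E)) x).eventually h
    filter_upwards [h1, extChartAt_source_mem_nhds (I := 𝓘(ℝ, E)) x] with y hy hy'
    exact (key y hy').2 hy

theorem realDeriv_smul {f : M → ℂ} {g : M → G} {x : M} (hf : SmoothNear (E := E) f x)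
    (hg : SmoothNear (E := E) g x) (v : E) :
    realDeriv (E := E) (fun y => f y • g y) x v =
      realDeriv f x v • g x + f x • realDeriv g x v := by
  have hf' := (smoothNear_iff_chart.1 hf).self_of_nhds.differentiableAt (by simp)
  have hg' := (smoothNear_iff_chart.1 hg).self_of_nhds.differentiableAt (by simp)
  rw [realDeriv_eq_fderiv (hf.smul hg).mdifferentiableAt,
    realDeriv_eq_fderiv hf.mdifferentiableAt, realDeriv_eq_fderiv hg.mdifferentiableAt]
  have h := fderiv_smul hf' hg'
  have h' := congrArg (fun L => L v) h
  simp only [Function.comp_apply, extChartAt_to_inv, add_apply,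
    smul_apply, ContinuousLinearMap.smulRight_apply] at h'
  rw [add_comm]
  exact h'

theorem coordDeriv_comp_symm {f : M → G} {x : M} (hf : SmoothNear (E := E) f x) (v : E) :
    ∀ᶠ z in nhds (extChartAt 𝓘(ℝ, E) x x),
      (coordDeriv x v f ∘ (extChartAt 𝓘(ℝ, E) x).symm) z =
        fderiv ℝ (f ∘ (extChartAt 𝓘(ℝ, E) x).symm) z v := by
  have h1 : Filter.Tendsto (extChartAt 𝓘(ℝ, E) x).symm (nhds (extChartAt 𝓘(ℝ, E) x x))
      (nhds x) := by
    have := continuousAt_extChartAt_symm (I := 𝓘(ℝ, E)) x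
    unfold ContinuousAt at this
    rwa [extChartAt_to_inv] at this
  filter_upwards [h1.eventually hf.eventually,
    extChartAt_target_mem_nhds (I := 𝓘(ℝ, E)) x] with z hz hz'
  have := coordDeriv_eq_fderiv ((extChartAt 𝓘(ℝ, E) x).map_target hz') v hz.mdifferentiableAt
  rwa [(extChartAt 𝓘(ℝ, E) x).right_inv hz'] at this

theorem SmoothNear.coordDeriv {f : M → G} {x : M} (hf : SmoothNear (E := E) f x) (v : E) :
    SmoothNear (E := E) (coordDeriv x v f) x := by
  rw [smoothNear_iff_chart] at hf ⊢
  filter_upwards [hf, eventually_eventually_nhds.2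
    (coordDeriv_comp_symm (smoothNear_iff_chart.2 hf) v)] with z hz hz'
  exact ((hz.fderiv_right (m := ∞) (by simp)).clm_apply contDiffAt_const).congr_of_eventuallyEq hz'

/-- Coordinate derivatives commute. -/
theorem coordDeriv_comm {f : M → G} {x : M} (hf : SmoothNear (E := E) f x) (v w : E) :
    CVHS.coordDeriv x v (CVHS.coordDeriv x w f) x =
      CVHS.coordDeriv x w (CVHS.coordDeriv x v f) x := by
  have key : ∀ v w : E, CVHS.coordDeriv x v (CVHS.coordDeriv x w f) x =
      fderiv ℝ (fderiv ℝ (f ∘ (extChartAt 𝓘(ℝ, E) x).symm)) (extChartAt 𝓘(ℝ, E) x x) v w := by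
    intro v w
    rw [coordDeriv_eq_fderiv (mem_extChartAt_source x) v (hf.coordDeriv w).mdifferentiableAt,
      Filter.EventuallyEq.fderiv_eq (coordDeriv_comp_symm hf w)]
    have hd : DifferentiableAt ℝ (fderiv ℝ (f ∘ (extChartAt 𝓘(ℝ, E) x).symm))
        (extChartAt 𝓘(ℝ, E) x x) :=
      ((smoothNear_iff_chart.1 hf).self_of_nhds.fderiv_right (m := ∞) (by simp)).differentiableAt
        (by simp)
    rw [fderiv_clm_apply hd (differentiableAt_const _)]
    simp
  rw [key, key]
  exact ((smoothNear_iff_chart.1 hf).self_of_nhds.isSymmSndFDerivAt (by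
    simp only [minSmoothness_of_isRCLikeNormedField]
    exact WithTop.coe_le_coe.2 (le_top : (2 : ℕ∞) ≤ ⊤))) v w

end Functions

/-! ### Smooth sections and the flat connection in a fixed flat trivialization. -/

section Sections

variable {E : Type*} [NormedAddCommGroup E] [NormedSpace ℂ E]
  {M : Type*} [TopologicalSpace M] [ChartedSpace E M]
  (F : Type*) [NormedAddCommGroup F] [NormedSpace ℂ F]
  {V : M → Type*} [∀ x, AddCommGroup (V x)] [∀ x, Module ℂ (V x)] [∀ x, TopologicalSpace (V x)]
  [TopologicalSpace (TotalSpace F V)] [FiberBundle F V] [VectorBundle ℂ F V]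

/-- The components of a section in the preferred flat trivialization at `x`. -/
def flatCoord (x : M) (s : ∀ y, V y) (y : M) : F :=
  (trivializationAt F V x).linearMapAt ℂ y (s y)

/-- The flat section with value `u` at `x`, extended by zero. -/
def constSection (x : M) (u : V x) (y : M) : V y :=
  (trivializationAt F V x).symmₗ ℂ y ((trivializationAt F V x).linearMapAt ℂ x u)

/-- The section `s` is smooth near `x`. -/
abbrev Sm (s : ∀ y, V y) (x : M) : Prop :=
  IsSmoothSectionNear (E := E) F (fun _ => ⊤) s x

variable {F}

theorem IsSmoothSectionNear.sm {L : ∀ x, Submodule ℂ (V x)} {s : ∀ y, V y} {x : M}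
    (hs : IsSmoothSectionNear (E := E) F L s x) : Sm (E := E) F s x :=
  hs.mono fun _ h => ⟨trivial, h.2⟩

theorem Sm.mem {L : ∀ x, Submodule ℂ (V x)} {s : ∀ y, V y} {x : M}
    (hs : Sm (E := E) F s x) (h : ∀ᶠ y in nhds x, s y ∈ L y) :
    IsSmoothSectionNear (E := E) F L s x := by
  filter_upwards [hs, h] with y h1 h2 using ⟨h2, h1.2⟩

theorem IsSmoothSectionNear.eventually {L : ∀ x, Submodule ℂ (V x)} {s : ∀ y, V y} {x : M}
    (hs : IsSmoothSectionNear (E := E) F L s x) :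
    ∀ᶠ y in nhds x, IsSmoothSectionNear (E := E) F L s y :=
  eventually_eventually_nhds.2 hs

theorem eventually_mem_baseSet (x : M) : ∀ᶠ y in nhds x, y ∈ (trivializationAt F V x).baseSet :=
  (trivializationAt F V x).open_baseSet.mem_nhds (mem_baseSet_trivializationAt F V x)

theorem constSection_self (x : M) (u : V x) : constSection F x u x = u :=
  (trivializationAt F V x).symmₗ_linearMapAt (mem_baseSet_trivializationAt F V x) u

theorem flatCoord_constSection (x : M) (u : V x) :
    ∀ᶠ y in nhds x, flatCoord F x (constSection F x u) y =
      (trivializationAt F V x).linearMapAt ℂ x u := by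
  filter_upwards [eventually_mem_baseSet (F := F) (V := V) x] with y hy
  exact (trivializationAt F V x).linearMapAt_symmₗ hy _

theorem symm_flatCoord {x y : M} (hy : y ∈ (trivializationAt F V x).baseSet) (s : ∀ y, V y) :
    (trivializationAt F V x).symmₗ ℂ y (flatCoord F x s y) = s y :=
  (trivializationAt F V x).symmₗ_linearMapAt hy _

theorem finiteDimensional_fiber [FiniteDimensional ℂ F] (x : M) : FiniteDimensional ℂ (V x) :=
  ((trivializationAt F V x).linearEquivAt ℂ x
    (mem_baseSet_trivializationAt F V x)).symm.finiteDimensional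

theorem finrank_fiber {x y : M} (hy : y ∈ (trivializationAt F V x).baseSet) :
    Module.finrank ℂ (V y) = Module.finrank ℂ F :=
  ((trivializationAt F V x).linearEquivAt ℂ y hy).finrank_eq

/-- The local system hypothesis enters here: near `y`, the preferred trivializations at `x` and at
`y` differ by one constant isomorphism. -/
theorem exists_transition (hflat : IsLocalSystem F V) {x y : M}
    (hy : y ∈ (trivializationAt F V x).baseSet) :
    ∃ c : F ≃L[ℂ] F, ∀ᶠ z in nhds y, ∀ u : V z,
      (trivializationAt F V y).linearMapAt ℂ z u =
        c ((trivializationAt F V x).linearMapAt ℂ z u) := by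
  refine ⟨(trivializationAt F V x).coordChangeL ℂ (trivializationAt F V y) y, ?_⟩
  have hy' := mem_baseSet_trivializationAt F V y
  filter_upwards [hflat (trivializationAt F V x) (trivializationAt F V y) y ⟨hy, hy'⟩,
    (trivializationAt F V x).open_baseSet.mem_nhds hy, eventually_mem_baseSet (F := F) (V := V) y] with z h1 h2 h3 u
  rw [← h1, Trivialization.coordChangeL_apply _ _ ⟨h2, h3⟩,
    Trivialization.coe_linearMapAt_of_mem _ h3, Trivialization.coe_linearMapAt_of_mem _ h2,
    Trivialization.symm_apply_apply_mk _ h2]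

/-- Smoothness at `y` is tested in the trivialization at `y`; the constant transition allows the
trivialization at `x` to be used for all nearby `y` at once. -/
theorem sm_iff (hflat : IsLocalSystem F V) {s : ∀ y, V y} {x : M} :
    Sm (E := E) F s x ↔ SmoothNear (E := E) (flatCoord F x s) x := by
  refine Filter.eventually_congr ?_
  filter_upwards [eventually_mem_baseSet (F := F) (V := V) x] with y hy
  obtain ⟨c, hc⟩ := exists_transition hflat hy
  have h1 : (fun z => ((trivializationAt F V y) ⟨z, s z⟩).2) =ᶠ[nhds y]
      fun z => c (flatCoord F x s z) := by
    filter_upwards [hc, eventually_mem_baseSet (F := F) (V := V) y] with z h1 h2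
    rw [flatCoord, ← h1, Trivialization.coe_linearMapAt_of_mem _ h2]
  rw [contMDiffAt_section, h1.contMDiffAt_iff]
  have hC : ∀ d : F ≃L[ℂ] F, ContDiff ℝ ∞ d := fun d =>
    (d.toContinuousLinearMap.restrictScalars ℝ).contDiff
  constructor
  · rintro ⟨-, h⟩
    have := (hC c.symm).contMDiff.contMDiffAt.comp y h
    simpa [Function.comp_def] using this
  · intro h
    exact ⟨trivial, (hC c).contMDiff.contMDiffAt.comp y h⟩

/-- `flatConn` uses a trivialization that moves with the point. A constant transition commutes with
differentiation, so a single trivialization suffices near `x`. -/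
theorem flatConn_eq (hflat : IsLocalSystem F V) {s : ∀ y, V y} {x y : M}
    (hy : y ∈ (trivializationAt F V x).baseSet)
    (hs : MDifferentiableAt 𝓘(ℝ, E) 𝓘(ℝ, F) (flatCoord F x s) y) (v : E) :
    flatConn F s y v = (trivializationAt F V x).symmₗ ℂ y (realDeriv (flatCoord F x s) y v) := by
  obtain ⟨c, hc⟩ := exists_transition hflat hy
  have h1 : ∀ᶠ z in nhds y, ((trivializationAt F V y) ⟨z, s z⟩).2 =
      c (flatCoord F x s z) := by
    filter_upwards [hc, eventually_mem_baseSet (F := F) (V := V) y] with z h1 h2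
    rw [flatCoord, ← h1, Trivialization.coe_linearMapAt_of_mem _ h2]
  have hy' := mem_baseSet_trivializationAt F V y
  change (trivializationAt F V y).symmₗ ℂ y (realDeriv _ y v) = _
  rw [realDeriv_congr h1]
  have h2 := realDeriv_clm (c.toContinuousLinearMap.restrictScalars ℝ) hs
  have h3 : realDeriv (E := E) (fun z => c (flatCoord F x s z)) y v =
    c (realDeriv (flatCoord F x s) y v) := congrArg (fun L => L v) h2
  rw [h3]
  have h4 := hc.self_of_nhds
    ((trivializationAt F V x).symmₗ ℂ y (realDeriv (flatCoord F x s) y v))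
  rw [(trivializationAt F V x).linearMapAt_symmₗ hy] at h4
  rw [← h4, (trivializationAt F V y).symmₗ_linearMapAt hy']

variable (F) in
/-- The covariant derivative along a coordinate field. -/
def nabla (x : M) (v : E) (s : ∀ y, V y) (y : M) : V y :=
  flatConn F s y (coordField x v y)

theorem Sm.add (hflat : IsLocalSystem F V) {s t : ∀ y, V y} {x : M} (hs : Sm (E := E) F s x)
    (ht : Sm (E := E) F t x) : Sm (E := E) F (fun y => s y + t y) x := by
  rw [sm_iff hflat] at *
  exact (SmoothNear.add hs ht).congr (.of_forall fun y => map_add _ _ _)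

theorem Sm.smul (hflat : IsLocalSystem F V) {f : M → ℂ} {s : ∀ y, V y} {x : M}
    (hf : SmoothNear (E := E) f x) (hs : Sm (E := E) F s x) :
    Sm (E := E) F (fun y => f y • s y) x := by
  rw [sm_iff hflat] at *
  exact (SmoothNear.smul hf hs).congr (.of_forall fun y => map_smul _ _ _)

theorem sm_zero (hflat : IsLocalSystem F V) (x : M) : Sm (E := E) F (fun y => (0 : V y)) x := by
  rw [sm_iff hflat]
  exact (smoothNear_const (0 : F) x).congr (.of_forall fun y => map_zero _)

theorem Sm.neg (hflat : IsLocalSystem F V) {s : ∀ y, V y} {x : M}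
    (hs : Sm (E := E) F s x) : Sm (E := E) F (fun y => - s y) x := by
  simpa using Sm.smul hflat (smoothNear_const (-1) x) hs

theorem Sm.sub (hflat : IsLocalSystem F V) {s t : ∀ y, V y} {x : M} (hs : Sm (E := E) F s x)
    (ht : Sm (E := E) F t x) : Sm (E := E) F (fun y => s y - t y) x := by
  simpa [sub_eq_add_neg] using hs.add hflat (ht.neg hflat)

theorem sm_sum (hflat : IsLocalSystem F V) {ι : Type*} (I : Finset ι) {s : ι → ∀ y, V y} {x : M}
    (hs : ∀ i ∈ I, Sm (E := E) F (s i) x) : Sm (E := E) F (fun y => ∑ i ∈ I, s i y) x := by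
  classical
  induction I using Finset.induction_on with
  | empty => simpa using sm_zero hflat x
  | insert a I ha ih =>
    simp only [Finset.sum_insert ha]
    exact (hs a (Finset.mem_insert_self a I)).add hflat
      (ih fun i hi => hs i (Finset.mem_insert_of_mem hi))

theorem Sm.congr (hflat : IsLocalSystem F V) {s t : ∀ y, V y} {x : M} (hs : Sm (E := E) F s x)
    (h : ∀ᶠ y in nhds x, t y = s y) : Sm (E := E) F t x := by
  rw [sm_iff hflat] at *
  exact hs.congr (h.mono fun y hy => by simp only [flatCoord, hy])

theorem sm_constSection (hflat : IsLocalSystem F V) (x : M) (u : V x) :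
    Sm (E := E) F (constSection F x u) x := by
  rw [sm_iff hflat]
  exact (smoothNear_const _ x).congr (flatCoord_constSection x u)

theorem flatConn_congr {s t : ∀ y, V y} {x : M} (h : ∀ᶠ y in nhds x, s y = t y) :
    flatConn (E := E) F s x = flatConn F t x := by
  unfold flatConn
  rw [realDeriv_congr (f := fun y => ((trivializationAt F V x) ⟨y, s y⟩).2)
    (g := fun y => ((trivializationAt F V x) ⟨y, t y⟩).2)]
  exact h.mono fun y hy => by simp only [hy]

theorem flatConn_self (hflat : IsLocalSystem F V) {s : ∀ y, V y} {x : M}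
    (hs : Sm (E := E) F s x) (v : E) :
    flatConn F s x v = (trivializationAt F V x).symmₗ ℂ x (realDeriv (flatCoord F x s) x v) :=
  flatConn_eq hflat (mem_baseSet_trivializationAt F V x)
    ((sm_iff hflat).1 hs).mdifferentiableAt v

theorem flatConn_add (hflat : IsLocalSystem F V) {s t : ∀ y, V y} {x : M}
    (hs : Sm (E := E) F s x) (ht : Sm (E := E) F t x) :
    flatConn (E := E) F (fun y => s y + t y) x = flatConn F s x + flatConn F t x := by
  ext v
  rw [LinearMap.add_apply, flatConn_self hflat (hs.add hflat ht), flatConn_self hflat hs,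
    flatConn_self hflat ht, ← map_add]
  have h1 : flatCoord F x (fun y => s y + t y) = fun y => flatCoord F x s y + flatCoord F x t y := by
    ext y; simp [flatCoord]
  rw [h1, realDeriv_add ((sm_iff hflat).1 hs) ((sm_iff hflat).1 ht)]
  rfl

theorem flatConn_zero (hflat : IsLocalSystem F V) (x : M) :
    flatConn (E := E) F (fun y => (0 : V y)) x = 0 := by
  have := flatConn_add (E := E) hflat (sm_zero hflat x) (sm_zero hflat x)
  simpa using this

variable [IsManifold 𝓘(ℝ, E) ∞ M]

theorem flatConn_smul (hflat : IsLocalSystem F V) {f : M → ℂ} {s : ∀ y, V y} {x : M}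
    (hf : SmoothNear (E := E) f x) (hs : Sm (E := E) F s x) (v : E) :
    flatConn F (fun y => f y • s y) x v = realDeriv f x v • s x + f x • flatConn F s x v := by
  rw [flatConn_self hflat (Sm.smul hflat hf hs), flatConn_self hflat hs]
  have h1 : flatCoord F x (fun y => f y • s y) = fun y => f y • flatCoord F x s y := by
    ext y; simp [flatCoord]
  rw [h1, realDeriv_smul hf ((sm_iff hflat).1 hs), map_add, map_smul, map_smul,
    symm_flatCoord (mem_baseSet_trivializationAt F V x)]

theorem flatCoord_nabla (hflat : IsLocalSystem F V) {s : ∀ y, V y} {x : M}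
    (hs : Sm (E := E) F s x) (v : E) :
    ∀ᶠ y in nhds x, flatCoord F x (nabla F x v s) y = coordDeriv x v (flatCoord F x s) y := by
  filter_upwards [eventually_mem_baseSet (F := F) (V := V) x,
    ((sm_iff hflat).1 hs).eventually] with y hy h1
  rw [flatCoord, nabla, flatConn_eq (F := F) hflat hy h1.mdifferentiableAt,
    (trivializationAt F V x).linearMapAt_symmₗ hy]
  rfl

theorem Sm.nabla (hflat : IsLocalSystem F V) {s : ∀ y, V y} {x : M}
    (hs : Sm (E := E) F s x) (v : E) : Sm (E := E) F (CVHS.nabla F x v s) x := by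
  rw [sm_iff hflat]
  exact (((sm_iff hflat).1 hs).coordDeriv v).congr (flatCoord_nabla hflat hs v)

theorem nabla_self (s : ∀ y, V y) (x : M) (v : E) :
    CVHS.nabla F x v s x = flatConn F s x v := by
  rw [CVHS.nabla, coordField_self]

/-- The connection is flat. -/
theorem nabla_comm (hflat : IsLocalSystem F V) {s : ∀ y, V y} {x : M}
    (hs : Sm (E := E) F s x) (v w : E) :
    flatConn F (CVHS.nabla F x w s) x v = flatConn F (CVHS.nabla F x v s) x w := by
  have key : ∀ v w : E, flatConn F (CVHS.nabla F x w s) x v =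
      (trivializationAt F V x).symmₗ ℂ x
        (coordDeriv x v (coordDeriv x w (flatCoord F x s)) x) := by
    intro v w
    rw [flatConn_self hflat (hs.nabla hflat w), realDeriv_congr (flatCoord_nabla hflat hs w),
      coordDeriv, coordField_self]
  rw [key, key, coordDeriv_comm ((sm_iff hflat).1 hs)]

end Sections

/-! ### Orthogonal projections for a possibly indefinite form, and Gram matrices. -/

section Gram

variable {U : Type*} [AddCommGroup U] [Module ℂ U]

/-- A sesquilinear form which is anisotropic on a finite-dimensional subspace admits an orthogonal
projection onto it. -/
theorem exists_orthogonal_projection [FiniteDimensional ℂ U] (h : U →ₗ[ℂ] U →ₗ⋆[ℂ] ℂ)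
    (L : Submodule ℂ U) (hL : ∀ u ∈ L, h u u = 0 → u = 0) :
    ∃ Q : U →ₗ[ℂ] U, (∀ u, Q u ∈ L) ∧ ∀ u, ∀ t ∈ L, h (u - Q u) t = 0 := by
  classical
  let b := Module.finBasis ℂ L
  let T : (Fin (Module.finrank ℂ L) → ℂ) →ₗ[ℂ] U := L.subtype ∘ₗ b.equivFun.symm.toLinearMap
  let A : U →ₗ[ℂ] (Fin (Module.finrank ℂ L) → ℂ) := LinearMap.pi fun i => h.flip (b i : U)
  have hT : ∀ c, T c ∈ L := fun c => (b.equivFun.symm c).2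
  have hA : ∀ u, A u = 0 → ∀ t ∈ L, h u t = 0 := by
    intro u hu t ht
    have h1 : t = ∑ i, b.repr ⟨t, ht⟩ i • (b i : U) := by
      have := congrArg Subtype.val (b.sum_repr ⟨t, ht⟩)
      simpa only [AddSubmonoidClass.coe_finsetSum, SetLike.val_smul] using this.symm
    rw [h1, map_sum]
    refine Finset.sum_eq_zero fun i _ => ?_
    rw [LinearMap.map_smulₛₗ, show h u (b i : U) = 0 from congrFun hu i, smul_zero]
  -- `A ∘ₗ T` is the Gram map of `L`: a vector in its kernel gives an element of `L` orthogonal to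
  -- `L`, in particular isotropic.
  have hinj : Function.Injective (A ∘ₗ T) := by
    rw [injective_iff_map_eq_zero]
    intro c hc
    have h1 := hL _ (hT c) (hA _ hc _ (hT c))
    exact b.equivFun.symm.map_eq_zero_iff.1 (Subtype.ext h1)
  let e := LinearEquiv.ofInjectiveEndo (A ∘ₗ T) hinj
  refine ⟨T ∘ₗ e.symm.toLinearMap ∘ₗ A, fun u => hT _, fun u t ht => hA _ ?_ t ht⟩
  rw [map_sub, sub_eq_zero]
  exact (e.apply_symm_apply (A u)).symm

/-- Cramer's rule for the coefficients of the orthogonal projection. -/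
theorem det_smul_eq_cramer {r : ℕ} (h : U →ₗ[ℂ] U →ₗ⋆[ℂ] ℂ) (e : Fin r → U) (u : U)
    (c : Fin r → ℂ) (hc : ∀ i, h (u - ∑ j, c j • e j) (e i) = 0) :
    (Matrix.of fun i j => h (e j) (e i)).det • c =
      (Matrix.of fun i j => h (e j) (e i)).cramer fun i => h u (e i) := by
  have h1 : (fun i => h u (e i)) = (Matrix.of fun i j => h (e j) (e i)).mulVec c := by
    ext i
    have := hc i
    rw [map_sub, LinearMap.sub_apply, sub_eq_zero] at this
    rw [this, map_sum, LinearMap.sum_apply]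
    simp [Matrix.mulVec, dotProduct, mul_comm]
  rw [h1, Matrix.cramer_eq_adjugate_mulVec, Matrix.mulVec_mulVec, Matrix.adjugate_mul,
    Matrix.smul_mulVec, Matrix.one_mulVec]

/-- A kernel vector of the Gram matrix would be the coefficient vector of an isotropic element of
the span. -/
theorem gram_det_ne_zero {r : ℕ} (h : U →ₗ[ℂ] U →ₗ⋆[ℂ] ℂ) {e : Fin r → U}
    (he : LinearIndependent ℂ e)
    (hL : ∀ u ∈ Submodule.span ℂ (Set.range e), h u u = 0 → u = 0) :
    (Matrix.of fun i j => h (e j) (e i)).det ≠ 0 := by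
  intro hdet
  obtain ⟨c, hc0, hc⟩ := Matrix.exists_mulVec_eq_zero_iff.2 hdet
  apply hc0
  have hm : ∑ j, c j • e j ∈ Submodule.span ℂ (Set.range e) :=
    Submodule.sum_mem _ fun j _ => Submodule.smul_mem _ _ (Submodule.subset_span ⟨j, rfl⟩)
  have h1 : ∀ i, h (∑ j, c j • e j) (e i) = 0 := by
    intro i
    have := congrFun hc i
    rw [map_sum, LinearMap.sum_apply]
    simpa [Matrix.mulVec, dotProduct, mul_comm] using this
  have h2 := hL _ hm (by
    conv_lhs => rw [map_sum (h _)]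
    refine Finset.sum_eq_zero fun i _ => ?_
    rw [LinearMap.map_smulₛₗ, h1, smul_zero])
  exact funext fun i => Fintype.linearIndependent_iff.1 he c h2 i

end Gram

/-! ### Smoothness of determinants and inverses. -/

section Det

variable {E : Type*} [NormedAddCommGroup E] [NormedSpace ℂ E]
  {M : Type*} [TopologicalSpace M] [ChartedSpace E M]

theorem SmoothNear.det {r : ℕ} {A : M → Matrix (Fin r) (Fin r) ℂ} {x : M}
    (hA : ∀ i j, SmoothNear (E := E) (fun y => A y i j) x) :
    SmoothNear (E := E) (fun y => (A y).det) x := by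
  have h1 : SmoothNear (E := E) (fun y (p : Fin r × Fin r) => A y p.1 p.2) x :=
    SmoothNear.pi fun p => hA p.1 p.2
  have h2 : ContDiff ℝ ∞ (fun B : Fin r × Fin r → ℂ =>
      (Matrix.of fun i j => B (i, j)).det) := by
    simp only [Matrix.det_apply]
    refine ContDiff.sum fun σ _ => ContDiff.const_smul _ (contDiff_prod fun i _ => ?_)
    exact contDiff_apply ℝ ℂ (σ i, i)
  exact h1.comp h2

theorem SmoothNear.inv {f : M → ℂ} {x : M} (hf : SmoothNear (E := E) f x) (h0 : f x ≠ 0) :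
    SmoothNear (E := E) (fun y => (f y)⁻¹) x := by
  filter_upwards [hf, hf.continuousAt.eventually_ne h0] with y h1 h2
  exact (contDiffAt_inv ℝ h2).contMDiffAt.comp y h1

end Det

/-! ### Smooth projections and smooth subbundles. -/

section Projections

variable {E : Type*} [NormedAddCommGroup E] [NormedSpace ℂ E]
  {M : Type*} [TopologicalSpace M] [ChartedSpace E M]
  (F : Type*) [NormedAddCommGroup F] [NormedSpace ℂ F]
  {V : M → Type*} [∀ x, AddCommGroup (V x)] [∀ x, Module ℂ (V x)] [∀ x, TopologicalSpace (V x)]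
  [TopologicalSpace (TotalSpace F V)] [FiberBundle F V] [VectorBundle ℂ F V]

/-- A field of endomorphisms which maps smooth sections to smooth sections. -/
def SmoothEnd (A : ∀ x, V x →ₗ[ℂ] V x) : Prop :=
  ∀ (x : M) (s : ∀ y, V y), Sm (E := E) F s x → Sm (E := E) F (fun y => A y (s y)) x

/-- A field of forms which maps smooth sections to smooth functions. -/
def SmoothForm (h : ∀ x, V x →ₗ[ℂ] V x →ₗ⋆[ℂ] ℂ) : Prop :=
  ∀ (x : M) (s t : ∀ y, V y), Sm (E := E) F s x → Sm (E := E) F t x →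
    SmoothNear (E := E) (fun y => h y (s y) (t y)) x

variable {F}

/-- In a local frame of `L`, Cramer's rule writes the coefficients of `Q s` as smooth functions
divided by the Gram determinant, which does not vanish because `h` is anisotropic on `L`. -/
theorem smoothEnd_of_orthogonal (hflat : IsLocalSystem F V)
    {h : ∀ x, V x →ₗ[ℂ] V x →ₗ⋆[ℂ] ℂ} (hh : SmoothForm (E := E) F h)
    {L : ∀ x, Submodule ℂ (V x)} (hL : IsSmoothSubbundle (E := E) F L)
    (hdef : ∀ x, ∀ u ∈ L x, h x u u = 0 → u = 0) {Q : ∀ x, V x →ₗ[ℂ] V x}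
    (hQ : ∀ x u, Q x u ∈ L x) (hQ' : ∀ x u, ∀ t ∈ L x, h x (u - Q x u) t = 0) :
    SmoothEnd (E := E) F Q := by
  intro x s hs
  obtain ⟨r, e, he, hspan⟩ := hL x
  let A : ∀ y, Matrix (Fin r) (Fin r) ℂ := fun y => Matrix.of fun i j => h y (e j y) (e i y)
  let b : ∀ y, Fin r → ℂ := fun y i => h y (s y) (e i y)
  have hA : ∀ i j, SmoothNear (E := E) (fun y => A y i j) x := fun i j =>
    hh x _ _ (he j).sm (he i).sm
  have hb : ∀ i, SmoothNear (E := E) (fun y => b y i) x := fun i => hh x _ _ hs (he i).sm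
  have hdet : ∀ᶠ y in nhds x, (A y).det ≠ 0 := by
    filter_upwards [hspan] with y hy
    exact gram_det_ne_zero (h y) hy.1 fun u hu => hdef y u (hy.2 ▸ hu)
  have hsm : Sm (E := E) F (fun y => ∑ j, ((A y).det⁻¹ * (A y).cramer (b y) j) • e j y) x := by
    refine sm_sum hflat _ fun j _ => Sm.smul hflat ?_ (he j).sm
    refine SmoothNear.smul ((SmoothNear.det hA).inv hdet.self_of_nhds) ?_
    simp only [Matrix.cramer_apply]
    refine SmoothNear.det fun k l => ?_
    by_cases hlj : l = j
    · subst hlj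
      simpa using hb k
    · simpa [Matrix.updateCol_apply, hlj] using hA k l
  refine hsm.congr hflat ?_
  filter_upwards [hspan, hdet] with y hy hy'
  have h1 := hQ y (s y)
  rw [← hy.2, Submodule.mem_span_range_iff_exists_fun] at h1
  obtain ⟨c, hc⟩ := h1
  have h2 := det_smul_eq_cramer (h y) (fun i => e i y) (s y) c fun i => by
    rw [hc]
    exact hQ' y _ _ (hy.2 ▸ Submodule.subset_span ⟨i, rfl⟩)
  rw [← hc]
  refine Finset.sum_congr rfl fun j _ => ?_
  have h3 : (A y).det * c j = (A y).cramer (b y) j := congrFun h2 j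
  rw [← h3, inv_mul_cancel_left₀ hy']

variable [FiniteDimensional ℂ F]

/-- The range of a smooth field of projections is a smooth subbundle. -/
theorem isSmoothSubbundle_of_projection (hflat : IsLocalSystem F V)
    {Q : ∀ x, V x →ₗ[ℂ] V x} (hQ : SmoothEnd (E := E) F Q) {L : ∀ x, Submodule ℂ (V x)}
    (hQL : ∀ x u, Q x u ∈ L x) (hQL' : ∀ x, ∀ u ∈ L x, Q x u = u) :
    IsSmoothSubbundle (E := E) F L := by
  intro x
  have hfin : ∀ y, FiniteDimensional ℂ (V y) := finiteDimensional_fiber (F := F)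
  have hrange : ∀ y, LinearMap.range (Q y) = L y := fun y =>
    le_antisymm (by rintro _ ⟨u, rfl⟩; exact hQL y u) fun u hu => ⟨u, hQL' y u hu⟩
  -- Flat extensions of bases of the range and of the kernel of `Q x` are pushed through `Q` and `1
  -- - Q`. Independence persists near `x`, so neither the rank nor the nullity of `Q` can drop;
  -- their sum is constant, so neither can jump.
  let bL := Module.finBasis ℂ (L x)
  let bK := Module.finBasis ℂ (LinearMap.ker (Q x))
  let s : Fin (Module.finrank ℂ (L x)) → ∀ y, V y := fun i y =>
    Q y (constSection F x (bL i : V x) y)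
  let t : Fin (Module.finrank ℂ (LinearMap.ker (Q x))) → ∀ y, V y := fun j y =>
    constSection F x (bK j : V x) y - Q y (constSection F x (bK j : V x) y)
  have hs : ∀ i, Sm (E := E) F (s i) x := fun i => hQ x _ (sm_constSection hflat x _)
  have ht : ∀ j, Sm (E := E) F (t j) x := fun j =>
    (sm_constSection hflat x _).sub hflat (hQ x _ (sm_constSection hflat x _))
  let f : Fin (Module.finrank ℂ (L x)) ⊕ Fin (Module.finrank ℂ (LinearMap.ker (Q x))) →
    ∀ y, V y := Sum.elim s t
  have hcont : ContinuousAt (fun y a => flatCoord F x (f a) y) x := by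
    rw [continuousAt_pi]
    rintro (i | j)
    · exact ((sm_iff hflat).1 (hs i)).continuousAt
    · exact ((sm_iff hflat).1 (ht j)).continuousAt
  have hdisj : Disjoint (L x) (LinearMap.ker (Q x)) := by
    rw [Submodule.disjoint_def]
    intro u hu hu'
    rw [← hQL' x u hu]; exact hu'
  have hindx : LinearIndependent ℂ fun a => f a x := by
    have h1 := bL.linearIndependent.map' (L x).subtype (L x).ker_subtype
    have h2 := bK.linearIndependent.map' _ (LinearMap.ker (Q x)).ker_subtype
    have h3 := h1.sum_type h2 (hdisj.mono
      (Submodule.span_le.2 (by rintro _ ⟨i, rfl⟩; exact (bL i).2))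
      (Submodule.span_le.2 (by rintro _ ⟨i, rfl⟩; exact (bK i).2)))
    have h4 : (fun a => f a x) =
        Sum.elim ((L x).subtype ∘ bL) ((LinearMap.ker (Q x)).subtype ∘ bK) := by
      ext (i | j)
      · change Q x (constSection F x (bL i : V x) x) = bL i
        rw [constSection_self, hQL' x _ (bL i).2]
      · change constSection F x (bK j : V x) x - Q x (constSection F x (bK j : V x) x) = bK j
        rw [constSection_self, show Q x (bK j) = 0 from (bK j).2, sub_zero]
    rw [h4]
    exact h3
  have hindF : LinearIndependent ℂ fun a => flatCoord F x (f a) x := by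
    refine hindx.map' ((trivializationAt F V x).linearMapAt ℂ x) (LinearMap.ker_eq_bot.2 ?_)
    exact Function.LeftInverse.injective ((trivializationAt F V x).symmₗ_linearMapAt
      (mem_baseSet_trivializationAt F V x))
  have hind : ∀ᶠ y in nhds x, LinearIndependent ℂ fun a => f a y := by
    filter_upwards [hcont.eventually (isOpen_setOfPred_linearIndependent.mem_nhds hindF)] with y hy
    exact LinearIndependent.of_comp ((trivializationAt F V x).linearMapAt ℂ y) hy
  refine ⟨_, s, fun i => (hs i).mem (.of_forall fun y => hQL y _), ?_⟩
  filter_upwards [hind, eventually_mem_baseSet (F := F) (V := V) x] with y hy hyb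
  have hsi : LinearIndependent ℂ fun i => s i y := hy.comp Sum.inl Sum.inl_injective
  have hti : LinearIndependent ℂ fun j => t j y := hy.comp Sum.inr Sum.inr_injective
  refine ⟨hsi, Submodule.eq_of_le_of_finrank_le ?_ ?_⟩
  · rw [Submodule.span_le]
    rintro _ ⟨i, rfl⟩
    exact hQL y _
  · have h1 := (Q x).finrank_range_add_finrank_ker
    have h2 := (Q y).finrank_range_add_finrank_ker
    rw [hrange, finrank_fiber (mem_baseSet_trivializationAt F V x)] at h1
    rw [hrange, finrank_fiber hyb] at h2
    have h3 : Module.finrank ℂ (Submodule.span ℂ (Set.range fun i => s i y)) =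
        Module.finrank ℂ (L x) := by
      rw [finrank_span_eq_card hsi, Fintype.card_fin]
    have h4 : Module.finrank ℂ (LinearMap.ker (Q x)) ≤ Module.finrank ℂ (LinearMap.ker (Q y)) := by
      have h5 : Submodule.span ℂ (Set.range fun j => t j y) ≤ LinearMap.ker (Q y) := by
        rw [Submodule.span_le]
        rintro _ ⟨j, rfl⟩
        simp only [SetLike.mem_coe, LinearMap.mem_ker, t, map_sub]
        rw [hQL' y _ (hQL y _), sub_self]
      have h6 := Submodule.finrank_mono h5
      rwa [finrank_span_eq_card hti, Fintype.card_fin] at h6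
    omega

end Projections

/-! ### Block-diagonal part of the flat connection: metric compatibility and curvature. -/

section Families

variable {E : Type*} [NormedAddCommGroup E] [NormedSpace ℂ E]
  {M : Type*} [TopologicalSpace M] [ChartedSpace E M]
  (F : Type*) [NormedAddCommGroup F] [NormedSpace ℂ F]
  {V : M → Type*} [∀ x, AddCommGroup (V x)] [∀ x, Module ℂ (V x)] [∀ x, TopologicalSpace (V x)]
  [TopologicalSpace (TotalSpace F V)] [FiberBundle F V] [VectorBundle ℂ F V]
  {ι : Type*}

/-- A smooth nondegenerate hermitian form on `V` which is preserved by the flat connection. -/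
structure IsFlatHermitian (h : ∀ x, V x →ₗ[ℂ] V x →ₗ⋆[ℂ] ℂ) : Prop where
  hermitian : ∀ x u t, h x u t = (starRingEnd ℂ) (h x t u)
  smooth : SmoothForm (E := E) F h
  flat : ∀ (x : M) (s t : ∀ y, V y), Sm (E := E) F s x → Sm (E := E) F t x → ∀ v : E,
    realDeriv (fun y => h y (s y) (t y)) x v =
      h x (flatConn F s x v) (t x) + h x (s x) (flatConn F t x v)
  nondeg : ∀ x u, (∀ t, h x u t = 0) → u = 0

/-- A locally finite family of smooth, mutually orthogonal projections with sum `1`. -/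
structure IsOrthFamily (h : ∀ x, V x →ₗ[ℂ] V x →ₗ⋆[ℂ] ℂ)
    (P : ι → ∀ x, V x →ₗ[ℂ] V x) : Prop where
  smooth : ∀ a, SmoothEnd (E := E) F (P a)
  finite : ∀ x, ∃ I : Finset ι, ∀ᶠ y in nhds x, ∀ a ∉ I, P a y = 0
  idem : ∀ a x u, P a x (P a x u) = P a x u
  ortho : ∀ a b, a ≠ b → ∀ x u, P a x (P b x u) = 0
  sum : ∀ x u, ∑ᶠ a, P a x u = u
  adj : ∀ a x u t, h x (P a x u) t = h x u (P a x t)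

/-- The part of the flat connection which preserves the summands of a decomposition of `V`. -/
def diagConn (P : ι → ∀ x, V x →ₗ[ℂ] V x) (s : ∀ x, V x) (x : M) : E →ₗ[ℝ] V x :=
  ∑ᶠ a, ((P a x).restrictScalars ℝ) ∘ₗ flatConn (E := E) F (fun y => P a y (s y)) x

/-- The derivative along a coordinate field for `diagConn`. -/
def diagNabla (P : ι → ∀ x, V x →ₗ[ℂ] V x) (x : M) (v : E) (s : ∀ x, V x) (y : M) : V y :=
  diagConn F P s y (coordField x v y)

variable {F} {h : ∀ x, V x →ₗ[ℂ] V x →ₗ⋆[ℂ] ℂ} {P : ι → ∀ x, V x →ₗ[ℂ] V x}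

theorem finsum_proj_apply {G : Type*} [AddCommMonoid G] {x : M} {I : Finset ι}
    (hI : ∀ a ∉ I, P a x = 0) (f : ι → (V x →ₗ[ℂ] V x) → G) (hf : ∀ a, f a 0 = 0) :
    ∑ᶠ a, f a (P a x) = ∑ a ∈ I, f a (P a x) := by
  apply finsum_eq_sum_of_support_subset
  intro a ha
  by_contra hn
  exact ha (by simp only [hI a (by simpa using hn), hf])

theorem IsOrthFamily.exists_finset (hP : IsOrthFamily (E := E) F h P) (x : M) :
    ∃ I : Finset ι, ∀ a ∉ I, P a x = 0 :=
  (hP.finite x).imp fun _ hI => hI.self_of_nhds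

theorem IsOrthFamily.sum_eq (hP : IsOrthFamily (E := E) F h P) {x : M} {I : Finset ι}
    (hI : ∀ a ∉ I, P a x = 0) (u : V x) : ∑ a ∈ I, P a x u = u := by
  conv_rhs => rw [← hP.sum x u, finsum_proj_apply hI (fun _ A => A u) (by simp)]

theorem IsOrthFamily.ext (hP : IsOrthFamily (E := E) F h P) {x : M} {u u' : V x}
    (huu' : ∀ a, P a x u = P a x u') : u = u' := by
  rw [← hP.sum x u, ← hP.sum x u']
  exact finsum_congr huu'

theorem diagConn_apply {x : M} {I : Finset ι} (hI : ∀ a ∉ I, P a x = 0) (s : ∀ x, V x) (v : E) :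
    diagConn F P s x v = ∑ a ∈ I, P a x (flatConn F (fun y => P a y (s y)) x v) := by
  rw [diagConn, finsum_proj_apply hI
    (fun a A => A.restrictScalars ℝ ∘ₗ flatConn (E := E) F (fun y => P a y (s y)) x)
    (fun a => by ext; simp), LinearMap.sum_apply]
  rfl

theorem diagConn_congr {s t : ∀ y, V y} {x : M} (h : ∀ᶠ y in nhds x, s y = t y) :
    diagConn (E := E) F P s x = diagConn F P t x := by
  unfold diagConn
  refine finsum_congr fun a => ?_
  rw [flatConn_congr]
  exact h.mono fun y hy => by simp only [hy]

theorem IsOrthFamily.proj_sum (hP : IsOrthFamily (E := E) F h P) {x : M} {I : Finset ι}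
    (hI : ∀ a ∉ I, P a x = 0) (a : ι) (u : ι → V x) :
    P a x (∑ b ∈ I, P b x (u b)) = P a x (u a) := by
  rw [map_sum]
  by_cases ha : a ∈ I
  · rw [Finset.sum_eq_single_of_mem a ha fun b _ hb => hP.ortho a b hb.symm x _, hP.idem]
  · simp [hI a ha]

theorem IsOrthFamily.proj_diagConn (hP : IsOrthFamily (E := E) F h P) (a : ι) (s : ∀ x, V x)
    (x : M) (v : E) :
    P a x (diagConn F P s x v) = P a x (flatConn F (fun y => P a y (s y)) x v) := by
  obtain ⟨I, hI⟩ := hP.exists_finset x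
  rw [diagConn_apply hI, hP.proj_sum hI a fun b => flatConn F (fun y => P b y (s y)) x v]

theorem IsOrthFamily.diagConn_proj (hP : IsOrthFamily (E := E) F h P) (hflat : IsLocalSystem F V)
    (a : ι) (s : ∀ x, V x) (x : M) (v : E) :
    diagConn F P (fun y => P a y (s y)) x v = P a x (diagConn F P s x v) := by
  refine hP.ext fun b => ?_
  rw [hP.proj_diagConn]
  by_cases hb : b = a
  · subst hb
    rw [hP.idem, hP.proj_diagConn]
    simp only [hP.idem]
  · rw [hP.ortho b a hb]
    simp only [hP.ortho b a hb, flatConn_zero hflat, LinearMap.zero_apply, map_zero]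

theorem IsOrthFamily.sm (hP : IsOrthFamily (E := E) F h P) (a : ι) {s : ∀ y, V y} {x : M}
    (hs : Sm (E := E) F s x) : Sm (E := E) F (fun y => P a y (s y)) x :=
  hP.smooth a x s hs

theorem IsOrthFamily.diagConn_add (hP : IsOrthFamily (E := E) F h P) (hflat : IsLocalSystem F V)
    {s t : ∀ y, V y} {x : M} (hs : Sm (E := E) F s x) (ht : Sm (E := E) F t x) :
    diagConn (E := E) F P (fun y => s y + t y) x = diagConn F P s x + diagConn F P t x := by
  ext v
  refine hP.ext fun a => ?_
  rw [LinearMap.add_apply, map_add, hP.proj_diagConn, hP.proj_diagConn, hP.proj_diagConn,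
    ← map_add, ← LinearMap.add_apply, ← flatConn_add hflat (hP.sm a hs) (hP.sm a ht)]
  simp only [map_add]

variable [IsManifold 𝓘(ℝ, E) ∞ M]

theorem IsOrthFamily.diagConn_smul (hP : IsOrthFamily (E := E) F h P)
    (hflat : IsLocalSystem F V) {f : M → ℂ} {s : ∀ y, V y} {x : M}
    (hf : SmoothNear (E := E) f x) (hs : Sm (E := E) F s x) (v : E) :
    diagConn F P (fun y => f y • s y) x v =
      realDeriv f x v • s x + f x • diagConn F P s x v := by
  refine hP.ext fun a => ?_
  rw [hP.proj_diagConn, map_add, map_smul, map_smul, hP.proj_diagConn]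
  simp only [map_smul]
  rw [flatConn_smul hflat hf (hP.sm a hs), map_add, map_smul, map_smul, hP.idem]

theorem diagNabla_self (s : ∀ y, V y) (x : M) (v : E) :
    diagNabla F P x v s x = diagConn F P s x v := by
  rw [diagNabla, coordField_self]

theorem IsOrthFamily.sm_diagNabla (hP : IsOrthFamily (E := E) F h P)
    (hflat : IsLocalSystem F V) {s : ∀ y, V y} {x : M} (hs : Sm (E := E) F s x) (v : E) :
    Sm (E := E) F (diagNabla F P x v s) x := by
  obtain ⟨I, hI⟩ := hP.finite x
  refine (sm_sum hflat I fun a _ => hP.sm a ((hP.sm a hs).nabla hflat v)).congr hflat ?_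
  filter_upwards [hI] with y hy
  rw [diagNabla, diagConn_apply hy]
  rfl

/-- Since `h(P_a s, t) = h(P_a s, P_a t)`, only the diagonal block of `∇` survives. Compatibility
thus holds summand by summand, and arbitrary constant weights may be inserted. -/
theorem IsFlatHermitian.realDeriv_proj (hh : IsFlatHermitian (E := E) F h)
    (hP : IsOrthFamily (E := E) F h P) (a : ι) {s t : ∀ y, V y} {x : M}
    (hs : Sm (E := E) F s x) (ht : Sm (E := E) F t x) (v : E) :
    realDeriv (fun y => h y (P a y (s y)) (t y)) x v =
      h x (P a x (diagConn F P s x v)) (t x) + h x (P a x (s x)) (diagConn F P t x v) := by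
  have h1 : (fun y => h y (P a y (s y)) (t y)) = fun y => h y (P a y (s y)) (P a y (t y)) := by
    ext y
    rw [← hP.adj, hP.idem]
  rw [h1, hh.flat x _ _ (hP.sm a hs) (hP.sm a ht), hP.proj_diagConn, hP.adj a x (s x), hP.adj,
    hP.adj a x (s x), hP.proj_diagConn]

/-- The connection `diagConn` is compatible with every form obtained from `h` by rescaling the
summands. -/
theorem IsFlatHermitian.realDeriv_weighted (hh : IsFlatHermitian (E := E) F h)
    (hP : IsOrthFamily (E := E) F h P) (c : ι → ℂ) {s t : ∀ y, V y} {x : M}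
    (hs : Sm (E := E) F s x) (ht : Sm (E := E) F t x) (v : E) :
    realDeriv (fun y => h y (∑ᶠ a, c a • P a y (s y)) (t y)) x v =
      h x (∑ᶠ a, c a • P a x (diagConn F P s x v)) (t x) +
        h x (∑ᶠ a, c a • P a x (s x)) (diagConn F P t x v) := by
  obtain ⟨I, hI⟩ := hP.finite x
  have key : ∀ y, (∀ a ∉ I, P a y = 0) → ∀ u t : V y,
      h y (∑ᶠ a, c a • P a y u) t = ∑ a ∈ I, c a • h y (P a y u) t := by
    intro y hy u t
    rw [finsum_proj_apply hy (fun a A => c a • A u) (by simp), map_sum, LinearMap.sum_apply]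
    simp
  have h1 : ∀ᶠ y in nhds x, h y (∑ᶠ a, c a • P a y (s y)) (t y) =
      ∑ a ∈ I, c a • h y (P a y (s y)) (t y) := hI.mono fun y hy => key y hy _ _
  have h2 : ∀ a, SmoothNear (E := E) (fun y => h y (P a y (s y)) (t y)) x :=
    fun a => hh.smooth x _ _ (hP.sm a hs) ht
  rw [realDeriv_congr h1,
    (realDeriv_sum I fun a _ => (smoothNear_const (c a) x).smul (h2 a)).2,
    key x hI.self_of_nhds, key x hI.self_of_nhds, ← Finset.sum_add_distrib,
    sum_apply]
  refine Finset.sum_congr rfl fun a _ => ?_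
  rw [realDeriv_smul (smoothNear_const (c a) x) (h2 a), realDeriv_const,
    hh.realDeriv_proj hP a hs ht, smul_add]
  simp

/-- With all weights equal to 1, `diagConn` preserves `h`, as `∇` does; subtracting the two product
rules gives the claim. -/
theorem IsFlatHermitian.skew (hh : IsFlatHermitian (E := E) F h)
    (hP : IsOrthFamily (E := E) F h P) {s t : ∀ y, V y} {x : M}
    (hs : Sm (E := E) F s x) (ht : Sm (E := E) F t x) (v : E) :
    h x (flatConn F s x v - diagConn F P s x v) (t x) +
      h x (s x) (flatConn F t x v - diagConn F P t x v) = 0 := by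
  have h1 := hh.realDeriv_weighted hP (fun _ => 1) hs ht v
  simp only [one_smul, hP.sum] at h1
  rw [hh.flat x s t hs ht] at h1
  rw [map_sub, map_sub, LinearMap.sub_apply]
  linear_combination h1

/-- The difference of the flat connection and its block-diagonal part is a one-form with values in
the endomorphisms of `V` which are skew-adjoint for `h`. -/
theorem IsFlatHermitian.exists_offDiagonal (hh : IsFlatHermitian (E := E) F h)
    (hP : IsOrthFamily (E := E) F h P) (hflat : IsLocalSystem F V) :
    ∃ θ : ∀ x, E →ₗ[ℝ] Module.End ℂ (V x),
      (∀ x s v, Sm (E := E) F s x →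
        flatConn F s x v = diagConn F P s x v + θ x v (s x)) ∧
      ∀ x v u t, h x (θ x v u) t = - h x u (θ x v t) := by
  have hc := fun x (u : V x) => sm_constSection (E := E) hflat x u
  have hadd : ∀ x (u u' : V x), constSection F x (u + u') =
      fun y => constSection F x u y + constSection F x u' y := by
    intro x u u'; ext y; simp [constSection]
  have hsmul : ∀ x (c : ℂ) (u : V x), constSection F x (c • u) =
      fun y => c • constSection F x u y := by
    intro x c u; ext y; simp [constSection]
  let θ : ∀ x, E →ₗ[ℝ] Module.End ℂ (V x) := fun x =>
    { toFun := fun v =>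
        { toFun := fun u => flatConn F (constSection F x u) x v -
            diagConn F P (constSection F x u) x v
          map_add' := fun u u' => by
            rw [hadd, flatConn_add hflat (hc x u) (hc x u'),
              hP.diagConn_add hflat (hc x u) (hc x u'), LinearMap.add_apply, LinearMap.add_apply]
            abel
          map_smul' := fun c u => by
            rw [hsmul, flatConn_smul hflat (smoothNear_const c x) (hc x u),
              hP.diagConn_smul hflat (smoothNear_const c x) (hc x u), realDeriv_const]
            simp [smul_sub] }
      map_add' := fun v w => by
        ext u
        simp only [map_add, LinearMap.coe_mk, AddHom.coe_mk, LinearMap.add_apply]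
        abel
      map_smul' := fun c v => by
        ext u
        simp [smul_sub] }
  have hskew : ∀ x v u t, h x (θ x v u) t = - h x u (θ x v t) := by
    intro x v u t
    have := hh.skew hP (hc x u) (hc x t) v
    rw [constSection_self, constSection_self] at this
    exact eq_neg_of_add_eq_zero_left this
  refine ⟨θ, fun x s v hs => ?_, hskew⟩
  -- `θ` was defined through flat extensions. That the difference of the connections at `x` depends
  -- only on `s x` follows by pairing with flat extensions of all `t`: skewness moves the operator
  -- onto `t`, and `h` is nondegenerate.
  rw [← sub_eq_iff_eq_add', ← sub_eq_zero]
  refine hh.nondeg x _ fun t => ?_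
  have h1 := hh.skew hP hs (hc x t) v
  rw [constSection_self] at h1
  have h2 := hskew x v (s x) t
  rw [map_sub, LinearMap.sub_apply, h2]
  change _ - - h x (s x) (flatConn F (constSection F x t) x v -
            diagConn F P (constSection F x t) x v) = 0
  linear_combination h1

variable {θ : ∀ x, E →ₗ[ℝ] Module.End ℂ (V x)}

theorem IsOrthFamily.proj_flatConn (hP : IsOrthFamily (E := E) F h P) (hflat : IsLocalSystem F V)
    (hθ : ∀ x s v, Sm (E := E) F s x → flatConn F s x v = diagConn F P s x v + θ x v (s x))
    {a b : ι} (hab : a ≠ b) {s : ∀ y, V y} {x : M} (hs : Sm (E := E) F s x) (v : E) :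
    P a x (flatConn F (fun y => P b y (s y)) x v) = P a x (θ x v (P b x (s x))) := by
  rw [hθ x _ v (hP.sm b hs), map_add, hP.diagConn_proj hflat, hP.ortho a b hab, zero_add]

/-- The whole diagonal block `P_a ∇ P_a` is already contained in `diagConn`. -/
theorem IsOrthFamily.offDiagonal_diag (hP : IsOrthFamily (E := E) F h P)
    (hflat : IsLocalSystem F V)
    (hθ : ∀ x s v, Sm (E := E) F s x → flatConn F s x v = diagConn F P s x v + θ x v (s x))
    (a : ι) (x : M) (v : E) (u : V x) : P a x (θ x v (P a x u)) = 0 := by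
  have h1 := hθ x _ v (hP.sm a (sm_constSection (E := E) hflat x u))
  have h2 := congrArg (P a x) h1
  rw [map_add, hP.proj_diagConn, constSection_self] at h2
  simpa only [hP.idem, left_eq_add] using h2

/-- The curvature of the block-diagonal part of the flat connection. -/
theorem IsOrthFamily.curvature (hP : IsOrthFamily (E := E) F h P) (hflat : IsLocalSystem F V)
    (hθ : ∀ x s v, Sm (E := E) F s x → flatConn F s x v = diagConn F P s x v + θ x v (s x))
    (a : ι) {s : ∀ y, V y} {x : M} (hs : Sm (E := E) F s x) (v w : E) :
    P a x (diagConn F P (diagNabla F P x w s) x v - diagConn F P (diagNabla F P x v s) x w) =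
      P a x (θ x w (θ x v (P a x (s x))) - θ x v (θ x w (P a x (s x)))) := by
  -- Split `∇_w P_a s` into its `diagConn` part, which stays in block `a`, and a remainder `t`
  -- without `a`-component. After `∇_v` and `P_a` the cross terms vanish: `θ` has no diagonal block
  -- and `diagConn` mixes no blocks.
  have key : ∀ v w : E, P a x (flatConn F (nabla F x w fun y => P a y (s y)) x v) =
      P a x (diagConn F P (diagNabla F P x w s) x v) + P a x (θ x v (θ x w (P a x (s x)))) := by
    intro v w
    have hs' := hP.sm a hs
    have hC := hP.sm_diagNabla hflat hs' w
    have hN := hs'.nabla hflat w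
    let t : ∀ y, V y := fun y =>
      nabla F x w (fun y => P a y (s y)) y - diagNabla F P x w (fun y => P a y (s y)) y
    have ht : Sm (E := E) F t x := hN.sub hflat hC
    have h1 : nabla F x w (fun y => P a y (s y)) =
        fun y => diagNabla F P x w (fun y => P a y (s y)) y + t y := by
      ext y; simp [t]
    have h2 : (fun y => P a y (t y)) = fun y => (0 : V y) := by
      ext y
      simp only [t, map_sub, diagNabla, hP.proj_diagConn, hP.idem, nabla, sub_self]
    have h3 : t x = θ x w (P a x (s x)) := by
      simp only [t, nabla_self, diagNabla_self]
      rw [hθ x _ w hs', add_sub_cancel_left]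
    have h4 : diagNabla F P x w (fun y => P a y (s y)) =
        fun y => P a y (diagNabla F P x w s y) := by
      ext y; exact hP.diagConn_proj hflat a s y _
    rw [h1, flatConn_add hflat hC ht, LinearMap.add_apply, map_add, hθ x _ v hC, hθ x _ v ht,
      map_add, map_add, h4, hP.offDiagonal_diag hflat hθ, h3, hP.diagConn_proj hflat, hP.idem,
      hP.proj_diagConn a t, h2, flatConn_zero hflat]
    simp
  have h1 := congrArg (P a x) (nabla_comm hflat (hP.sm a hs) v w)
  rw [key, key] at h1
  rw [map_sub, map_sub, sub_eq_sub_iff_add_eq_add, h1, add_comm]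

end Families

/-! ### Pointwise linear algebra: trace identities and the sign of the Chern form. -/

section Hermitian

variable {U : Type*} [AddCommGroup U] [Module ℂ U]
  {g : U →ₗ[ℂ] U →ₗ⋆[ℂ] ℂ}

theorem exists_orthonormal_trace [FiniteDimensional ℂ U]
    (hherm : ∀ u t, g u t = (starRingEnd ℂ) (g t u)) (hpos : ∀ u, u ≠ 0 → 0 < (g u u).re) :
    ∃ b : Module.Basis (Fin (Module.finrank ℂ U)) ℂ U,
      ∀ A : Module.End ℂ U, LinearMap.trace ℂ U A = ∑ k, g (A (b k)) (b k) := by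
  have h0 : ∀ u, g u u = 0 → u = 0 := by
    intro u hu
    by_contra hne
    have := hpos u hne
    rw [hu] at this
    exact lt_irrefl _ this
  let core : InnerProductSpace.Core ℂ U :=
    -- The arguments are swapped because `g` is linear in its first variable and `inner` in its
    -- second.
    { inner := fun x y => g y x
      conj_inner_symm := fun x y => (hherm y x).symm
      re_inner_nonneg := fun x => by
        by_cases hx : x = 0
        · simp [hx]
        · exact (hpos x hx).le
      add_left := fun x y z => by simp
      smul_left := fun x y r => by simp
      definite := h0 }
  let _ : NormedAddCommGroup U := core.toNormedAddCommGroup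
  let _ : InnerProductSpace ℂ U := InnerProductSpace.ofCore core.toCore
  exact ⟨(stdOrthonormalBasis ℂ U).toBasis, fun A => by
    rw [LinearMap.trace_eq_sum_inner A (stdOrthonormalBasis ℂ U)]
    simp only [OrthonormalBasis.coe_toBasis]
    rfl⟩

/-- Conjugation by the involution `ε` preserves the trace but changes the sign of `B * A`. -/
theorem trace_mul_eq_zero_of_anticommute {ε B A : Module.End ℂ U} (hε : ε * ε = 1)
    (hB : ε * B = B * ε) (hA : ε * A = - (A * ε)) :
    LinearMap.trace ℂ U (B * A) = 0 ∧ LinearMap.trace ℂ U (A * B) = 0 := by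
  have h1 : LinearMap.trace ℂ U (B * A) = - LinearMap.trace ℂ U (B * A) := by
    calc LinearMap.trace ℂ U (B * A) = LinearMap.trace ℂ U (ε * (ε * (B * A))) := by
          rw [← mul_assoc ε ε, hε, one_mul]
      _ = LinearMap.trace ℂ U ((ε * (B * A)) * ε) := LinearMap.trace_mul_comm _ _ _
      _ = LinearMap.trace ℂ U (-(B * A)) := by
          congr 1
          rw [← mul_assoc ε, hB, mul_assoc B, hA, mul_neg, neg_mul, ← mul_assoc, mul_assoc _ ε ε,
            hε, mul_one]
      _ = _ := map_neg _ _
  have h2 : LinearMap.trace ℂ U (B * A) = 0 := self_eq_neg.1 h1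
  exact ⟨h2, by rw [LinearMap.trace_mul_comm, h2]⟩

variable {E : Type*} [AddCommGroup E] [Module ℂ E]

/-- The pointwise computation of the first Chern form: `N` is the second fundamental form, whose
parts that commute and anticommute with the sign operator `ε` are of type `(1,0)` and `(0,1)`. -/
theorem trace_secondFundamentalForm [FiniteDimensional ℂ U]
    (hherm : ∀ u t, g u t = (starRingEnd ℂ) (g t u)) (hpos : ∀ u, u ≠ 0 → 0 < (g u u).re)
    {ε : Module.End ℂ U} (hε : ε * ε = 1) (hεg : ∀ u t, g (ε u) t = g u (ε t))
    {N N' : E → Module.End ℂ U} (hadj : ∀ v u t, g (ε (N v u)) t = - g (ε u) (N' v t))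
    (hβ : ∀ v, N (Complex.I • v) + ε * N (Complex.I • v) * ε =
      Complex.I • (N v + ε * N v * ε))
    (hη : ∀ v, N (Complex.I • v) - ε * N (Complex.I • v) * ε =
      -(Complex.I • (N v - ε * N v * ε)))
    {Φ : E → E → ℂ} (hΦ : ∀ v w, Φ v w = Complex.I / (2 * Real.pi) *
      (LinearMap.trace ℂ U (N' w * N v) - LinearMap.trace ℂ U (N' v * N w))) (v w : E) :
    (Φ v w).im = 0 ∧ Φ w v = -Φ v w ∧ Φ (Complex.I • v) (Complex.I • w) = Φ v w ∧
      (Φ v (Complex.I • v)).re ≤ 0 ∧ (Φ v (Complex.I • v) = 0 → N v = 0) := by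
  have hε' : ∀ u, ε (ε u) = u := fun u => congrArg (fun A : Module.End ℂ U => A u) hε
  have hN : ∀ v u t, g (N v u) t = - g u (ε (N' v (ε t))) := by
    intro v u t
    have := hadj v u (ε t)
    rwa [hεg, hε', hεg] at this
  have hN2 : ∀ v u t, g (ε (N v (ε u))) t = - g u (N' v t) := by
    intro v u t
    rw [hadj, hε']
  -- `β` and `η` are twice the even and odd parts of `N` with respect to conjugation by `ε`.
  let β : E → Module.End ℂ U := fun v => N v + ε * N v * ε
  let η : E → Module.End ℂ U := fun v => N v - ε * N v * ε
  let β' : E → Module.End ℂ U := fun v => N' v + ε * N' v * ε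
  let η' : E → Module.End ℂ U := fun v => N' v - ε * N' v * ε
  -- The `g`-adjoint of `N` is `-ε N' ε`. Conjugation by `ε` fixes `β'` and negates `η'`, whence the
  -- opposite signs in `hβadj` and `hηadj`.
  have hβadj : ∀ v u t, g (β v u) t = - g u (β' v t) := by
    intro v u t
    simp only [β, β', LinearMap.add_apply, Module.End.mul_apply, map_add, hN, hN2]
    ring
  have hηadj : ∀ v u t, g (η v u) t = g u (η' v t) := by
    intro v u t
    simp only [η, η', LinearMap.sub_apply, Module.End.mul_apply, map_sub, hN, hN2]
    ring
  have hcom : ∀ A : Module.End ℂ U, ε * (A + ε * A * ε) = (A + ε * A * ε) * ε := by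
    intro A
    rw [mul_add, add_mul, mul_assoc (ε * A), hε, mul_one, ← mul_assoc, ← mul_assoc, hε, one_mul,
      add_comm]
  have hanti : ∀ A : Module.End ℂ U, ε * (A - ε * A * ε) = -((A - ε * A * ε) * ε) := by
    intro A
    rw [mul_sub, sub_mul, mul_assoc (ε * A), hε, mul_one, ← mul_assoc, ← mul_assoc, hε, one_mul,
      neg_sub]
  obtain ⟨b, hb⟩ := exists_orthonormal_trace hherm hpos
  let S : E → E → ℂ := fun v w => ∑ k, g (β w (b k)) (β v (b k))
  let T : E → E → ℂ := fun v w => ∑ k, g (η w (b k)) (η v (b k))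
  have hS : ∀ v w, LinearMap.trace ℂ U (β' v * β w) = - S v w := by
    intro v w
    rw [hb, ← Finset.sum_neg_distrib]
    refine Finset.sum_congr rfl fun k _ => ?_
    rw [Module.End.mul_apply, hherm, ← neg_eq_iff_eq_neg.2 (hβadj v _ _), map_neg, ← hherm]
  have hT : ∀ v w, LinearMap.trace ℂ U (η' v * η w) = T v w := by
    intro v w
    rw [hb]
    refine Finset.sum_congr rfl fun k _ => ?_
    rw [Module.End.mul_apply, hherm, ← hηadj v, ← hherm]
  -- The factor `1 / 4` undoes the two doublings; the mixed products of an even and an odd part are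
  -- traceless.
  have hτ : ∀ v w, LinearMap.trace ℂ U (N' v * N w) = (1 / 4) * (T v w - S v w) := by
    intro v w
    have h1 : (4 : ℂ) • (N' v * N w) =
        β' v * β w + η' v * η w + (β' v * η w + η' v * β w) := by
      simp only [β, η, β', η']
      rw [show (4 : ℂ) • (N' v * N w) = 4 * (N' v * N w) from by
        rw [← Algebra.smul_mul_assoc, Algebra.smul_def, map_ofNat, mul_assoc]]
      noncomm_ring
    have h2 := congrArg (LinearMap.trace ℂ U) h1
    simp only [map_add, map_smul, hS, hT] at h2
    rw [(trace_mul_eq_zero_of_anticommute hε (hcom (N' v)) (hanti (N w))).1,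
      (trace_mul_eq_zero_of_anticommute hε (hcom (N w)) (hanti (N' v))).2, smul_eq_mul] at h2
    linear_combination (1 / 4) * h2
  have hSconj : ∀ v w, (starRingEnd ℂ) (S v w) = S w v := fun v w => by
    simp only [S, map_sum, ← hherm]
  have hTconj : ∀ v w, (starRingEnd ℂ) (T v w) = T w v := fun v w => by
    simp only [T, map_sum, ← hherm]
  have hβI : ∀ v, β (Complex.I • v) = Complex.I • β v := hβ
  have hηI : ∀ v, η (Complex.I • v) = -(Complex.I • η v) := hη
  have hS1 : ∀ v w, S (Complex.I • v) w = - Complex.I * S v w := fun v w => by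
    simp [S, hβI, Finset.mul_sum]
  have hS2 : ∀ v w, S v (Complex.I • w) = Complex.I * S v w := fun v w => by
    simp [S, hβI, Finset.mul_sum]
  have hT1 : ∀ v w, T (Complex.I • v) w = Complex.I * T v w := fun v w => by
    simp [T, hηI, Finset.mul_sum]
  have hT2 : ∀ v w, T v (Complex.I • w) = - Complex.I * T v w := fun v w => by
    simp [T, hηI, Finset.mul_sum]
  have hnn : ∀ u, 0 ≤ (g u u).re := fun u => by
    by_cases hu : u = 0
    · simp [hu]
    · exact (hpos u hu).le
  have h0 : ∀ u, (g u u).re = 0 → u = 0 := fun u hu => by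
    by_contra hne
    exact (hpos u hne).ne' hu
  have hSre : 0 ≤ (S v v).re := by
    rw [Complex.re_sum]; exact Finset.sum_nonneg fun k _ => hnn _
  have hTre : 0 ≤ (T v v).re := by
    rw [Complex.re_sum]; exact Finset.sum_nonneg fun k _ => hnn _
  have hpi : (Real.pi : ℂ) ≠ 0 := by exact_mod_cast Real.pi_ne_zero
  -- `S` and `T` enter `hτ` with opposite signs and transform under `J` by opposite factors of `i`,
  -- so here they add up.
  have hJ : Φ v (Complex.I • v) = ((-(1 / (4 * Real.pi)) : ℝ) : ℂ) * (S v v + T v v) := by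
    rw [hΦ, hτ, hτ, hS1, hS2, hT1, hT2]
    push_cast
    field_simp
    ring_nf
    rw [Complex.I_sq]
    ring
  have hpi' : 0 < 1 / (4 * Real.pi) := by positivity
  refine ⟨?_, ?_, ?_, ?_, ?_⟩
  · rw [← Complex.conj_eq_iff_im, hΦ, hτ, hτ]
    simp only [map_mul, map_sub, map_div₀, hSconj, hTconj, Complex.conj_I, Complex.conj_ofReal,
      map_one, map_ofNat]
    ring
  · rw [hΦ, hΦ]; ring
  · rw [hΦ, hΦ, hτ, hτ, hτ, hτ, hS1, hS2, hS1, hS2, hT1, hT2, hT1, hT2]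
    ring_nf
    simp only [show Complex.I ^ 3 = - Complex.I from Complex.I_pow_three]
    ring
  · rw [hJ, Complex.re_ofReal_mul, Complex.add_re]
    nlinarith
  · intro hz
    rw [hJ, mul_eq_zero] at hz
    have h1 := hz.resolve_left (by exact_mod_cast (neg_lt_zero.2 hpi').ne)
    have h2 := congrArg Complex.re h1
    rw [Complex.add_re, Complex.zero_re] at h2
    have hSz : (S v v).re = 0 := by linarith
    have hTz : (T v v).re = 0 := by linarith
    rw [Complex.re_sum, Finset.sum_eq_zero_iff_of_nonneg fun k _ => hnn _] at hSz hTz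
    refine b.ext fun k => ?_
    have h3 : β v (b k) = 0 := h0 _ (hSz k (Finset.mem_univ k))
    have h4 : η v (b k) = 0 := h0 _ (hTz k (Finset.mem_univ k))
    have h5 : (2 : ℂ) • N v (b k) = β v (b k) + η v (b k) := by
      simp only [β, η, LinearMap.add_apply, LinearMap.sub_apply, two_smul]
      abel
    rw [h3, h4, add_zero] at h5
    exact (smul_eq_zero.1 h5).resolve_left two_ne_zero

end Hermitian

/-! ### The Hodge decomposition and its refinement by `W` and `W^⊥`. -/

section HodgeFamily

variable {E : Type*} [NormedAddCommGroup E] [NormedSpace ℂ E]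
  {M : Type*} [TopologicalSpace M] [ChartedSpace E M]
  {F : Type*} [NormedAddCommGroup F] [NormedSpace ℂ F]
  {V : M → Type*} [∀ x, AddCommGroup (V x)] [∀ x, Module ℂ (V x)] [∀ x, TopologicalSpace (V x)]
  [TopologicalSpace (TotalSpace F V)] [FiberBundle F V] [VectorBundle ℂ F V]
  {H : ℤ → ∀ x, Submodule ℂ (V x)} {h : ∀ x, V x →ₗ[ℂ] V x →ₗ⋆[ℂ] ℂ}

theorem isCompl_of_iSupIndep {U ι : Type*} [AddCommGroup U] [Module ℂ U] {L : ι → Submodule ℂ U}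
    (hind : iSupIndep L) (hsum : ⨆ p, L p = ⊤) (p : ι) : IsCompl (L p) (⨆ q, ⨆ (_ : q ≠ p), L q) := by
  refine ⟨hind p, codisjoint_iff.2 (top_le_iff.1 ?_)⟩
  rw [← hsum]
  refine iSup_le fun q => ?_
  by_cases hq : q = p
  · subst hq; exact le_sup_left
  · exact le_sup_of_le_right (le_iSup₂_of_le (f := fun q (_ : q ≠ p) => L q) q hq le_rfl)

/-- The images of a flat frame form a basis at `x`, hence stay independent nearby. This serves to
show that the Hodge decomposition is locally finite. -/
theorem SmoothEnd.eventually_surjective [FiniteDimensional ℂ F] (hflat : IsLocalSystem F V)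
    {A : ∀ x, V x →ₗ[ℂ] V x} (hA : SmoothEnd (E := E) F A) {x : M} (hx : ∀ u, A x u = u) :
    ∀ᶠ y in nhds x, LinearMap.range (A y) = ⊤ := by
  have hfin : ∀ y, FiniteDimensional ℂ (V y) := finiteDimensional_fiber (F := F)
  let b := Module.finBasis ℂ (V x)
  let s : Fin (Module.finrank ℂ (V x)) → ∀ y, V y := fun i y => A y (constSection F x (b i) y)
  have hs : ∀ i, Sm (E := E) F (s i) x := fun i => hA x _ (sm_constSection hflat x _)
  have hcont : ContinuousAt (fun y a => flatCoord F x (s a) y) x :=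
    continuousAt_pi.2 fun i => ((sm_iff hflat).1 (hs i)).continuousAt
  have hindF : LinearIndependent ℂ fun a => flatCoord F x (s a) x := by
    have h1 : (fun a => flatCoord F x (s a) x) =
        (trivializationAt F V x).linearMapAt ℂ x ∘ b := by
      ext i
      simp only [flatCoord, s, Function.comp_apply, constSection_self, hx]
    rw [h1]
    refine b.linearIndependent.map' _ (LinearMap.ker_eq_bot.2 ?_)
    exact Function.LeftInverse.injective ((trivializationAt F V x).symmₗ_linearMapAt
      (mem_baseSet_trivializationAt F V x))
  filter_upwards [hcont.eventually (isOpen_setOfPred_linearIndependent.mem_nhds hindF),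
    eventually_mem_baseSet (F := F) (V := V) x] with y hy hyb
  have h2 : LinearIndependent ℂ fun i => s i y :=
    LinearIndependent.of_comp ((trivializationAt F V x).linearMapAt ℂ y) hy
  rw [← top_le_iff, ← h2.span_eq_top_of_card_eq_finrank' (by
    rw [Fintype.card_fin, finrank_fiber hyb,
      finrank_fiber (mem_baseSet_trivializationAt F V x)]), Submodule.span_le]
  rintro _ ⟨i, rfl⟩
  exact ⟨_, rfl⟩

section Pointwise

variable (hV : IsPolarizedVariation (E := E) F (fun _ => ⊤) H h)
include hV

theorem IsPolarizedVariation.isCompl (p : ℤ) (x : M) :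
    IsCompl (H p x) (⨆ q, ⨆ (_ : q ≠ p), H q x) :=
  isCompl_of_iSupIndep (hV.hodge_indep x) (hV.hodge_sum x) p

theorem IsPolarizedVariation.hodgeProj_eq (p : ℤ) (x : M) :
    hodgeProj H p x = Submodule.projection _ _ (hV.isCompl p x) := by
  rw [hodgeProj, dif_pos (hV.isCompl p x)]

theorem IsPolarizedVariation.hodgeProj_mem (p : ℤ) (x : M) (u : V x) :
    hodgeProj H p x u ∈ H p x := by
  rw [hV.hodgeProj_eq]
  exact (Submodule.projectionOnto (H p x) _ (hV.isCompl p x) u).2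

theorem IsPolarizedVariation.hodgeProj_of_mem {p : ℤ} {x : M} {u : V x} (hu : u ∈ H p x) :
    hodgeProj H p x u = u := by
  rw [hV.hodgeProj_eq]
  exact Submodule.projection_apply_left (hV.isCompl p x) ⟨u, hu⟩

theorem IsPolarizedVariation.hodgeProj_of_mem_ne {p q : ℤ} (hpq : q ≠ p) {x : M} {u : V x}
    (hu : u ∈ H q x) : hodgeProj H p x u = 0 := by
  rw [hV.hodgeProj_eq, Submodule.projection_apply_eq_zero_iff]
  exact Submodule.mem_iSup_of_mem q (Submodule.mem_iSup_of_mem hpq hu)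

theorem IsPolarizedVariation.herm (x : M) (u t : V x) : h x u t = (starRingEnd ℂ) (h x t u) :=
  hV.hermitian x u trivial t trivial

theorem IsPolarizedVariation.orthogonal_sub (p : ℤ) (x : M) (u : V x) {t : V x} (ht : t ∈ H p x) :
    h x (u - hodgeProj H p x u) t = 0 := by
  have h1 : u - hodgeProj H p x u ∈ ⨆ q, ⨆ (_ : q ≠ p), H q x := by
    rw [← Submodule.projection_apply_eq_zero_iff (hV.isCompl p x), ← hV.hodgeProj_eq, map_sub,
      hV.hodgeProj_of_mem (hV.hodgeProj_mem p x u), sub_self]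
  have h2 : ⨆ q, ⨆ (_ : q ≠ p), H q x ≤ LinearMap.ker ((h x).flip t) :=
    iSup₂_le fun q hq u' hu' => hV.orthogonal x q p hq u' hu' t ht
  exact h2 h1

theorem IsPolarizedVariation.anisotropic (p : ℤ) (x : M) {u : V x} (hu : u ∈ H p x)
    (h0 : h x u u = 0) : u = 0 := by
  by_contra hne
  have := hV.positive x p u hu hne
  rw [h0, mul_zero] at this
  exact lt_irrefl _ this

theorem IsPolarizedVariation.smoothForm : SmoothForm (E := E) F h := by
  intro x s t hs ht
  filter_upwards [hs.eventually, ht.eventually] with y h1 h2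
  exact hV.form_smooth y s t h1 h2

theorem IsPolarizedVariation.smoothEnd_hodgeProj (hflat : IsLocalSystem F V) (p : ℤ) :
    SmoothEnd (E := E) F (hodgeProj H p) :=
  smoothEnd_of_orthogonal hflat hV.smoothForm (hV.hodge_subbundle p)
    (fun x _ hu => hV.anisotropic p x hu) (hV.hodgeProj_mem p)
    fun x u _ ht => hV.orthogonal_sub p x u ht

theorem IsPolarizedVariation.sum_hodgeProj_of_finset {x : M} {I : Finset ℤ}
    (hI : ∀ p ∉ I, H p x = ⊥) (u : V x) : ∑ p ∈ I, hodgeProj H p x u = u := by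
  have h1 : ⨆ p, H p x ≤ LinearMap.eqLocus (∑ p ∈ I, hodgeProj H p x) LinearMap.id := by
    refine iSup_le fun q u hu => ?_
    rw [LinearMap.mem_eqLocus, LinearMap.sum_apply, LinearMap.id_apply]
    by_cases hq : q ∈ I
    · rw [Finset.sum_eq_single_of_mem q hq fun p _ hp => hV.hodgeProj_of_mem_ne hp.symm hu,
        hV.hodgeProj_of_mem hu]
    · rw [hI q hq, Submodule.mem_bot] at hu
      simp [hu]
  have h2 := h1 (by rw [hV.hodge_sum x]; trivial : u ∈ ⨆ p, H p x)
  rwa [LinearMap.mem_eqLocus, LinearMap.sum_apply, LinearMap.id_apply] at h2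

theorem IsPolarizedVariation.hodgeProj_ortho {p q : ℤ} (hpq : p ≠ q) (x : M) (u : V x) :
    hodgeProj H p x (hodgeProj H q x u) = 0 :=
  hV.hodgeProj_of_mem_ne hpq.symm (hV.hodgeProj_mem q x u)

theorem IsPolarizedVariation.exists_finset_hodge [FiniteDimensional ℂ F] (x : M) :
    ∃ I : Finset ℤ, ∀ p ∉ I, H p x = ⊥ := by
  have hfin : FiniteDimensional ℂ (V x) := finiteDimensional_fiber (F := F) x
  have h1 := WellFoundedGT.finite_ne_bot_of_iSupIndep (hV.hodge_indep x)
  exact ⟨h1.toFinset, fun p hp => by simpa using hp⟩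

theorem IsPolarizedVariation.isOrthFamily [FiniteDimensional ℂ F] (hflat : IsLocalSystem F V) :
    IsOrthFamily (E := E) F h (hodgeProj H) where
  smooth := hV.smoothEnd_hodgeProj hflat
  finite x := by
    obtain ⟨I, hI⟩ := hV.exists_finset_hodge x
    refine ⟨I, ?_⟩
    -- `I` collects the degrees present at `x` only. The sum of the projections over `I` is the
    -- identity at `x`, hence surjective nearby, and a projection of degree outside `I` kills its
    -- range.
    have hA : SmoothEnd (E := E) F (fun y => ∑ p ∈ I, hodgeProj H p y) := fun y s hs => by
      simpa only [LinearMap.sum_apply] using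
        sm_sum hflat I fun p _ => hV.smoothEnd_hodgeProj hflat p y s hs
    filter_upwards [hA.eventually_surjective hflat fun u => by
      rw [LinearMap.sum_apply]; exact hV.sum_hodgeProj_of_finset hI u] with y hy p hp
    ext u
    obtain ⟨u', rfl⟩ := LinearMap.range_eq_top.1 hy u
    rw [LinearMap.sum_apply, map_sum, LinearMap.zero_apply]
    exact Finset.sum_eq_zero fun q hq => hV.hodgeProj_ortho (fun hpq => hp (by rw [hpq]; exact hq)) y u'
  idem p x u := hV.hodgeProj_of_mem (hV.hodgeProj_mem p x u)
  ortho p q hpq x u := hV.hodgeProj_ortho hpq x u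
  sum x u := by
    obtain ⟨I, hI⟩ := hV.exists_finset_hodge x
    rw [finsum_proj_apply (P := hodgeProj H) (I := I) (fun p hp => ?_) (fun _ A => A u) (by simp)]
    · exact hV.sum_hodgeProj_of_finset hI u
    · ext u
      have := hV.hodgeProj_mem p x u
      rwa [hI p hp, Submodule.mem_bot] at this
  adj p x u t := by
    have h1 := hV.orthogonal_sub p x u (hV.hodgeProj_mem p x t)
    have h2 := hV.orthogonal_sub p x t (hV.hodgeProj_mem p x u)
    rw [map_sub, LinearMap.sub_apply, sub_eq_zero] at h1 h2
    rw [h1, hV.herm, h2, ← hV.herm]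

theorem IsPolarizedVariation.isFlatHermitian [FiniteDimensional ℂ F] (hflat : IsLocalSystem F V) :
    IsFlatHermitian (E := E) F h where
  hermitian := hV.herm
  smooth := hV.smoothForm
  flat := hV.form_flat
  nondeg x u hu := by
    have hP := hV.isOrthFamily hflat
    refine hP.ext fun p => ?_
    rw [map_zero]
    refine hV.anisotropic p x (hV.hodgeProj_mem p x u) ?_
    rw [hP.adj, hu]

end Pointwise

/-- A refinement of the Hodge decomposition by two complementary orthogonal graded subbundles
`W true` and `W false`: the summands of `W b` are the ranges of the projections `R (p, b)`. -/
structure IsHodgeRefinement (h : ∀ x, V x →ₗ[ℂ] V x →ₗ⋆[ℂ] ℂ) (F : Type*) [NormedAddCommGroup F]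
    [NormedSpace ℂ F] [TopologicalSpace (TotalSpace F V)] [FiberBundle F V] [VectorBundle ℂ F V]
    (H : ℤ → ∀ x, Submodule ℂ (V x))
    (R : ℤ × Bool → ∀ x, V x →ₗ[ℂ] V x) (W : Bool → ∀ x, Submodule ℂ (V x)) : Prop where
  family : IsOrthFamily (E := E) F h R
  hodge : ∀ p x u, hodgeProj H p x u = R (p, true) x u + R (p, false) x u
  mem : ∀ b x u, u ∈ W b x ↔ ∀ p, R (p, !b) x u = 0

theorem hodgeSign_apply {x : M} {I : Finset ℤ} (hI : ∀ p ∉ I, hodgeProj H p x = 0) (u : V x) :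
    hodgeSign H x u = ∑ p ∈ I, (-1 : ℂ) ^ p • hodgeProj H p x u := by
  rw [hodgeSign, finsum_proj_apply (P := hodgeProj H) hI (fun p A => (-1 : ℂ) ^ p • A) (by simp),
    LinearMap.sum_apply]
  rfl

theorem IsPolarizedVariation.hodgeProj_hodgeSign [FiniteDimensional ℂ F]
    (hV : IsPolarizedVariation (E := E) F (fun _ => ⊤) H h) (hflat : IsLocalSystem F V)
    (p : ℤ) (x : M) (u : V x) :
    hodgeProj H p x (hodgeSign H x u) = (-1 : ℂ) ^ p • hodgeProj H p x u := by
  have hP := hV.isOrthFamily hflat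
  obtain ⟨I, hI⟩ := hP.exists_finset x
  rw [hodgeSign_apply hI]
  have := hP.proj_sum hI p fun p => (-1 : ℂ) ^ p • u
  simpa only [map_smul] using this

/-- A graded smooth subbundle and its orthogonal complement refine the Hodge decomposition. -/
theorem IsPolarizedVariation.exists_refinement [FiniteDimensional ℂ F]
    (hV : IsPolarizedVariation (E := E) F (fun _ => ⊤) H h) (hflat : IsLocalSystem F V)
    {W : ∀ x, Submodule ℂ (V x)} (hgr : ∀ x, ⨆ p, W x ⊓ H p x = W x)
    (hsub : ∀ p, IsSmoothSubbundle (E := E) F (fun x => W x ⊓ H p x)) :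
    ∃ R : ℤ × Bool → ∀ x, V x →ₗ[ℂ] V x,
      IsHodgeRefinement (E := E) h F H R (fun b => bif b then W else perp H h W) := by
  have hfin : ∀ y, FiniteDimensional ℂ (V y) := finiteDimensional_fiber (F := F)
  have hP := hV.isOrthFamily hflat
  have hani : ∀ p x, ∀ u ∈ W x ⊓ H p x, h x u u = 0 → u = 0 := fun p x u hu =>
    hV.anisotropic p x hu.2
  choose Q hQ hQ' using fun p x => exists_orthogonal_projection (h x) (W x ⊓ H p x) (hani p x)
  have hQsm : ∀ p, SmoothEnd (E := E) F (Q p) := fun p =>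
    smoothEnd_of_orthogonal hflat hV.smoothForm (hsub p) (hani p) (hQ p) (hQ' p)
  have hQid : ∀ p x, ∀ u ∈ W x ⊓ H p x, Q p x u = u := by
    intro p x u hu
    have h1 := (W x ⊓ H p x).sub_mem hu (hQ p x u)
    exact (sub_eq_zero.1 (hani p x _ h1 (hQ' p x u _ h1))).symm
  have hPQ : ∀ p x u, hodgeProj H p x (Q p x u) = Q p x u := fun p x u =>
    hV.hodgeProj_of_mem (hQ p x u).2
  -- The part of `u` outside `H p` is `h`-orthogonal to `H p`, hence is killed by `Q p`.
  have hQP : ∀ p x u, Q p x (hodgeProj H p x u) = Q p x u := by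
    intro p x u
    have hm := hQ p x (u - hodgeProj H p x u)
    have h1 := hQ' p x (u - hodgeProj H p x u) _ hm
    rw [map_sub, LinearMap.sub_apply, hV.orthogonal_sub p x u hm.2, zero_sub, neg_eq_zero] at h1
    have h2 := hani p x _ hm h1
    rw [map_sub, sub_eq_zero] at h2
    exact h2.symm
  have hQadj : ∀ p x u t, h x (Q p x u) t = h x u (Q p x t) := by
    intro p x u t
    have h1 := hQ' p x u _ (hQ p x t)
    have h2 := hQ' p x t _ (hQ p x u)
    rw [map_sub, LinearMap.sub_apply, sub_eq_zero] at h1 h2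
    rw [h1, hV.herm, h2, ← hV.herm]
  -- The second block is simply what `Q p` leaves of `H p`; it is identified below with the degree
  -- `p` part of `perp`.
  let R : ℤ × Bool → ∀ x, V x →ₗ[ℂ] V x := fun a x =>
    bif a.2 then Q a.1 x else hodgeProj H a.1 x - Q a.1 x
  have hRP : ∀ a x u, R a x (hodgeProj H a.1 x u) = R a x u := by
    rintro ⟨p, _ | _⟩ x u <;> simp [R, hQP, hP.idem]
  have hPR : ∀ a x u, hodgeProj H a.1 x (R a x u) = R a x u := by
    rintro ⟨p, _ | _⟩ x u <;> simp [R, hPQ, hP.idem]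
  have hR : IsOrthFamily (E := E) F h R := by
    refine ⟨?_, ?_, ?_, ?_, ?_, ?_⟩
    · rintro ⟨p, _ | _⟩ x s hs
      · exact (hP.sm p hs).sub hflat (hQsm p x s hs)
      · exact hQsm p x s hs
    · intro x
      obtain ⟨I, hI⟩ := hP.finite x
      refine ⟨I ×ˢ Finset.univ, hI.mono fun y hy a ha => ?_⟩
      ext u
      rw [← hRP, hy a.1 fun h => ha (by simp [h])]
      simp
    · rintro ⟨p, _ | _⟩ x u
      · simp [R, hPQ, hP.idem, hQP, hQid p x _ (hQ p x u)]
      · exact hQid p x _ (hQ p x u)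
    · rintro ⟨p, b⟩ ⟨q, c⟩ hab x u
      by_cases hpq : p = q
      · subst hpq
        cases b <;> cases c <;>
          first
          | exact absurd rfl hab
          | simp [R, hPQ, hQP, hQid p x _ (hQ p x u)]
      · rw [← hPR (q, c), ← hRP (p, b), hP.ortho p q hpq, map_zero]
    · intro x u
      obtain ⟨I, hI⟩ := hP.exists_finset x
      rw [finsum_proj_apply (P := R) (I := I ×ˢ Finset.univ) (fun a ha => by
        ext u
        rw [← hRP, hI a.1 fun h => ha (by simp [h])]
        simp) (fun _ A => A u) (by simp), Finset.sum_product]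
      refine Eq.trans (Finset.sum_congr rfl fun p _ => ?_) (hP.sum_eq hI u)
      simp [R]
    · rintro ⟨p, _ | _⟩ x u t
      · simp [R, hP.adj, hQadj]
      · exact hQadj p x u t
  have hcov : ∀ p x u, hodgeProj H p x u = R (p, true) x u + R (p, false) x u := by
    intro p x u; simp [R]
  have hRsign : ∀ a x u, R a x (hodgeSign H x u) = (-1 : ℂ) ^ a.1 • R a x u := by
    intro a x u
    rw [← hRP, hV.hodgeProj_hodgeSign hflat, map_smul, hRP]
  have hWmem : ∀ x u, u ∈ W x ↔ ∀ p, R (p, false) x u = 0 := by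
    intro x u
    constructor
    · intro hu p
      rw [← hgr x] at hu
      have h1 : ⨆ q, W x ⊓ H q x ≤ LinearMap.ker (R (p, false) x) := by
        refine iSup_le fun q u hu => ?_
        rw [LinearMap.mem_ker]
        by_cases hq : q = p
        · subst hq
          simp [R, hV.hodgeProj_of_mem hu.2, hQid q x u hu]
        · rw [← hRP, hV.hodgeProj_of_mem_ne hq hu.2, map_zero]
      exact h1 hu
    · intro hu
      obtain ⟨I, hI⟩ := hP.exists_finset x
      rw [← hP.sum_eq hI u]
      refine Submodule.sum_mem _ fun p _ => ?_
      rw [hcov, hu, add_zero]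
      exact (hQ p x u).1
  refine ⟨R, hR, hcov, ?_⟩
  rintro (_ | _) x u
  -- On `H p` the Hodge metric is `(-1)^p h`; as `W` is graded, orthogonality to `W` is the same
  -- condition for both forms, degree by degree.
  · change u ∈ (W x).orthogonalBilin _ ↔ ∀ p, R (p, true) x u = 0
    rw [Submodule.mem_orthogonalBilin_iff]
    constructor
    · intro hu p
      have h1 := hu _ (hQ p x u).1
      have h2 : hodgeSign H x (Q p x u) = (-1 : ℂ) ^ p • Q p x u := by
        refine hP.ext fun q => ?_
        rw [hV.hodgeProj_hodgeSign hflat, map_smul]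
        by_cases hq : q = p
        · rw [hq]
        · rw [hV.hodgeProj_of_mem_ne (Ne.symm hq) (hQ p x u).2, smul_zero, smul_zero]
      have h3 : (-1 : ℂ) ^ p * h x (Q p x u) u = 0 := by
        change h x (hodgeSign H x (Q p x u)) u = 0 at h1
        rwa [h2, map_smul, LinearMap.smul_apply, smul_eq_mul] at h1
      have h4 : h x (Q p x u) u = 0 :=
        (mul_eq_zero.1 h3).resolve_left (zpow_ne_zero _ (by norm_num))
      refine hani p x (Q p x u) (hQ p x u) ?_
      rw [← hQadj, hQid p x _ (hQ p x u), h4]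
    · intro hu n hn
      change h x (hodgeSign H x n) u = 0
      obtain ⟨I, hI⟩ := hR.exists_finset x
      rw [← hR.sum_eq hI (hodgeSign H x n), map_sum, LinearMap.sum_apply]
      refine Finset.sum_eq_zero fun a _ => ?_
      obtain ⟨p, _ | _⟩ := a
      · rw [hRsign, (hWmem x n).1 hn, smul_zero, map_zero, LinearMap.zero_apply]
      · rw [hR.adj, hu, map_zero]
  · exact hWmem x u

end HodgeFamily

/-! ### Operators that are scalar on each summand. -/

section Weighted

variable {E : Type*} [NormedAddCommGroup E] [NormedSpace ℂ E]
  {M : Type*} [TopologicalSpace M] [ChartedSpace E M]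
  {F : Type*} [NormedAddCommGroup F] [NormedSpace ℂ F]
  {V : M → Type*} [∀ x, AddCommGroup (V x)] [∀ x, Module ℂ (V x)] [∀ x, TopologicalSpace (V x)]
  [TopologicalSpace (TotalSpace F V)] [FiberBundle F V] [VectorBundle ℂ F V]
  {ι : Type*} {h : ∀ x, V x →ₗ[ℂ] V x →ₗ⋆[ℂ] ℂ} {P : ι → ∀ x, V x →ₗ[ℂ] V x}

/-- The operator equal to `c a` on the `a`-th summand. -/
def weighted (c : ι → ℂ) (P : ι → ∀ x, V x →ₗ[ℂ] V x) (x : M) : V x →ₗ[ℂ] V x :=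
  ∑ᶠ a, c a • P a x

theorem weighted_apply {x : M} {I : Finset ι} (hI : ∀ a ∉ I, P a x = 0) (c : ι → ℂ) (u : V x) :
    weighted c P x u = ∑ a ∈ I, c a • P a x u := by
  rw [weighted, finsum_proj_apply hI (fun a A => c a • A) (by simp), LinearMap.sum_apply]
  rfl

theorem IsOrthFamily.weighted_eq_finsum (hP : IsOrthFamily (E := E) F h P) (c : ι → ℂ) (x : M)
    (u : V x) : weighted c P x u = ∑ᶠ a, c a • P a x u := by
  obtain ⟨I, hI⟩ := hP.exists_finset x
  rw [weighted_apply hI, finsum_proj_apply hI (fun a A => c a • A u) (by simp)]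

theorem IsOrthFamily.proj_weighted (hP : IsOrthFamily (E := E) F h P) (c : ι → ℂ) (a : ι) (x : M)
    (u : V x) : P a x (weighted c P x u) = c a • P a x u := by
  obtain ⟨I, hI⟩ := hP.exists_finset x
  rw [weighted_apply hI]
  simpa only [map_smul] using hP.proj_sum hI a fun a => c a • u

theorem IsOrthFamily.weighted_proj (hP : IsOrthFamily (E := E) F h P) (c : ι → ℂ) (a : ι) (x : M)
    (u : V x) : weighted c P x (P a x u) = c a • P a x u := by
  refine hP.ext fun b => ?_
  rw [hP.proj_weighted, map_smul]
  by_cases hb : b = a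
  · rw [hb]
  · rw [hP.ortho b a hb, smul_zero, smul_zero]

theorem IsOrthFamily.sm_weighted (hP : IsOrthFamily (E := E) F h P) (hflat : IsLocalSystem F V)
    (c : ι → ℂ) : SmoothEnd (E := E) F (weighted c P) := by
  intro x s hs
  obtain ⟨I, hI⟩ := hP.finite x
  refine (sm_sum hflat I fun a _ => Sm.smul hflat (smoothNear_const (c a) x)
    (hP.sm a hs)).congr hflat ?_
  filter_upwards [hI] with y hy
  exact weighted_apply hy c (s y)

theorem IsOrthFamily.adj_weighted (hP : IsOrthFamily (E := E) F h P) {c : ι → ℂ}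
    (hc : ∀ a, (starRingEnd ℂ) (c a) = c a) (x : M) (u t : V x) :
    h x (weighted c P x u) t = h x u (weighted c P x t) := by
  obtain ⟨I, hI⟩ := hP.exists_finset x
  rw [weighted_apply hI, weighted_apply hI, map_sum, map_sum, LinearMap.sum_apply]
  refine Finset.sum_congr rfl fun a _ => ?_
  rw [map_smul, LinearMap.smul_apply, LinearMap.map_smulₛₗ, hc, hP.adj]

end Weighted

/-! ### Types of the blocks of `θ`. -/

section Refinement

variable {E : Type*} [NormedAddCommGroup E] [NormedSpace ℂ E]
  {M : Type*} [TopologicalSpace M] [ChartedSpace E M]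
  {F : Type*} [NormedAddCommGroup F] [NormedSpace ℂ F]
  {V : M → Type*} [∀ x, AddCommGroup (V x)] [∀ x, Module ℂ (V x)] [∀ x, TopologicalSpace (V x)]
  [TopologicalSpace (TotalSpace F V)] [FiberBundle F V] [VectorBundle ℂ F V]
  {H : ℤ → ∀ x, Submodule ℂ (V x)} {h : ∀ x, V x →ₗ[ℂ] V x →ₗ⋆[ℂ] ℂ}
  {R : ℤ × Bool → ∀ x, V x →ₗ[ℂ] V x} {W : Bool → ∀ x, Submodule ℂ (V x)}

theorem part10_add_part01 {U : Type*} [AddCommGroup U] [Module ℂ U] (α : E →ₗ[ℝ] U)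
    (v : E) : part10 α v + part01 α v = α v := by
  rw [part10, part01, ← smul_add, sub_add_add_cancel, ← two_smul ℂ, smul_smul]
  norm_num

theorem map_part10 {U U' : Type*} [AddCommGroup U] [Module ℂ U] [AddCommGroup U'] [Module ℂ U']
    (A : U →ₗ[ℂ] U') (α : E →ₗ[ℝ] U) (v : E) :
    A (part10 α v) = part10 (A.restrictScalars ℝ ∘ₗ α) v := by
  simp [part10]

theorem map_part01 {U U' : Type*} [AddCommGroup U] [Module ℂ U] [AddCommGroup U'] [Module ℂ U']
    (A : U →ₗ[ℂ] U') (α : E →ₗ[ℝ] U) (v : E) :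
    A (part01 α v) = part01 (A.restrictScalars ℝ ∘ₗ α) v := by
  simp [part01]

theorem eq_of_part10_eq_zero {U : Type*} [AddCommGroup U] [Module ℂ U] {α : E →ₗ[ℝ] U} {v : E}
    (hα : part10 α v = 0) : α (Complex.I • v) = -(Complex.I • α v) := by
  have h1 := (smul_eq_zero.1 hα).resolve_left (by norm_num)
  rw [sub_eq_zero] at h1
  rw [h1, smul_smul, Complex.I_mul_I, neg_one_smul, neg_neg]

theorem eq_of_part01_eq_zero {U : Type*} [AddCommGroup U] [Module ℂ U] {α : E →ₗ[ℝ] U} {v : E}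
    (hα : part01 α v = 0) : α (Complex.I • v) = Complex.I • α v := by
  have h1 := (smul_eq_zero.1 hα).resolve_left (by norm_num)
  rw [eq_neg_of_add_eq_zero_left h1, smul_neg, smul_smul, Complex.I_mul_I, neg_one_smul, neg_neg]

variable (hR : IsHodgeRefinement (E := E) h F H R W)
include hR

theorem IsHodgeRefinement.proj_hodgeProj (a : ℤ × Bool) (x : M) (u : V x) :
    R a x (hodgeProj H a.1 x u) = R a x u := by
  obtain ⟨p, _ | _⟩ := a
  · rw [hR.hodge, map_add, hR.family.ortho _ _ (by simp), zero_add, hR.family.idem]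
  · rw [hR.hodge, map_add, hR.family.ortho (p, true) (p, false) (by simp), add_zero,
      hR.family.idem]

theorem IsHodgeRefinement.hodgeProj_proj (a : ℤ × Bool) (x : M) (u : V x) :
    hodgeProj H a.1 x (R a x u) = R a x u := by
  obtain ⟨p, _ | _⟩ := a
  · rw [hR.hodge, hR.family.ortho (p, true) (p, false) (by simp), zero_add, hR.family.idem]
  · rw [hR.hodge, hR.family.ortho (p, false) (p, true) (by simp), add_zero, hR.family.idem]

theorem IsHodgeRefinement.proj_mem (p : ℤ) (b : Bool) (x : M) (u : V x) :
    R (p, b) x u ∈ W b x :=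
  (hR.mem b x _).2 fun q => hR.family.ortho (q, !b) (p, b) (by simp) x u

theorem IsHodgeRefinement.hodgeProj_of_mem {p : ℤ} {b : Bool} {x : M} {u : V x} (hu : u ∈ W b x) :
    hodgeProj H p x u = R (p, b) x u := by
  have h1 := (hR.mem b x u).1 hu p
  cases b
  · rw [hR.hodge, show R (p, true) x u = 0 from h1, zero_add]
  · rw [hR.hodge, show R (p, false) x u = 0 from h1, add_zero]

theorem IsHodgeRefinement.proj_hodgeSign [FiniteDimensional ℂ F] (hflat : IsLocalSystem F V)
    (hV : IsPolarizedVariation (E := E) F (fun _ => ⊤) H h) (a : ℤ × Bool) (x : M) (u : V x) :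
    R a x (hodgeSign H x u) = (-1 : ℂ) ^ a.1 • R a x u := by
  rw [← hR.proj_hodgeProj, hV.hodgeProj_hodgeSign hflat, map_smul, hR.proj_hodgeProj]

theorem IsHodgeRefinement.hodgeSign_eq [FiniteDimensional ℂ F] (hflat : IsLocalSystem F V)
    (hV : IsPolarizedVariation (E := E) F (fun _ => ⊤) H h) (x : M) (u : V x) :
    hodgeSign H x u = ∑ᶠ a : ℤ × Bool, (-1 : ℂ) ^ a.1 • R a x u := by
  rw [← hR.family.weighted_eq_finsum fun a : ℤ × Bool => (-1 : ℂ) ^ a.1]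
  refine hR.family.ext fun a => ?_
  rw [hR.proj_hodgeSign hflat hV, hR.family.proj_weighted]

theorem IsHodgeRefinement.proj_hodgeConn [FiniteDimensional ℂ F] (hflat : IsLocalSystem F V)
    (hV : IsPolarizedVariation (E := E) F (fun _ => ⊤) H h) (a : ℤ × Bool) (s : ∀ x, V x) (x : M)
    (v : E) : R a x (hodgeConn F H s x v) =
      R a x (flatConn F (fun y => hodgeProj H a.1 y (s y)) x v) := by
  rw [← hR.proj_hodgeProj]
  change R a x (hodgeProj H a.1 x (diagConn F (hodgeProj H) s x v)) = _
  rw [(hV.isOrthFamily hflat).proj_diagConn, hR.proj_hodgeProj]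

theorem IsHodgeRefinement.proj_higgs [FiniteDimensional ℂ F] (hflat : IsLocalSystem F V)
    (hV : IsPolarizedVariation (E := E) F (fun _ => ⊤) H h) (a : ℤ × Bool) (s : ∀ x, V x) (x : M)
    (v : E) : R a x (higgs F H s x v) =
      R a x (flatConn F (fun y => hodgeProj H (a.1 + 1) y (s y)) x v) := by
  have hP := hV.isOrthFamily hflat
  obtain ⟨I, hI⟩ := hP.exists_finset x
  have h1 : higgs F H s x v =
      ∑ q ∈ I, hodgeProj H q x (flatConn F (fun y => hodgeProj H (q + 1) y (s y)) x v) := by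
    -- `higgs` is indexed by the source degree `p`, whereas `I` bounds the target degree `q = p -
    -- 1`.
    rw [higgs, finsum_eq_sum_of_support_subset (s := I.image (· + 1)), LinearMap.sum_apply,
      Finset.sum_image fun _ _ _ _ => add_right_cancel]
    · refine Finset.sum_congr rfl fun q _ => ?_
      simp only [LinearMap.coe_comp, Function.comp_apply, LinearMap.coe_restrictScalars,
        add_sub_cancel_right]
    · intro p hp
      by_contra hn
      refine hp ?_
      ext w
      have h2 : hodgeProj H (p - 1) x = 0 := hI _ fun hmem =>
        hn (Finset.mem_coe.2 (Finset.mem_image.2 ⟨p - 1, hmem, by ring⟩))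
      simp [h2]
  rw [h1, ← hR.proj_hodgeProj,
    hP.proj_sum hI a.1 fun q => flatConn F (fun y => hodgeProj H (q + 1) y (s y)) x v,
    hR.proj_hodgeProj]

theorem IsHodgeRefinement.graded (b : Bool) (x : M) (hmem : ∀ p u, hodgeProj H p x u ∈ H p x) :
    ⨆ p, W b x ⊓ H p x = W b x := by
  refine le_antisymm (iSup_le fun p => inf_le_left) fun u hu => ?_
  obtain ⟨I, hI⟩ := hR.family.exists_finset x
  rw [← hR.family.sum_eq hI u]
  refine Submodule.sum_mem _ fun ⟨p, c⟩ _ => ?_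
  by_cases hc : c = b
  · subst hc
    refine Submodule.mem_iSup_of_mem p ⟨hR.proj_mem p c x u, ?_⟩
    rw [← hR.hodgeProj_proj (p, c)]
    exact hmem p _
  · have hc' : c = !b := by cases c <;> cases b <;> simp_all
    rw [hc', (hR.mem b x u).1 hu]
    exact Submodule.zero_mem _

theorem IsHodgeRefinement.section_eq {b : Bool} {s : ∀ y, V y} {x : M}
    (hs : IsSmoothSectionNear (E := E) F (W b) s x) (p : ℤ) :
    ∀ᶠ y in nhds x, R (p, !b) y (s y) = 0 := by
  filter_upwards [hs] with y hy using (hR.mem b y _).1 hy.1 p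

theorem IsHodgeRefinement.hodgeProj_section {b : Bool} {s : ∀ y, V y} {x : M}
    (hs : IsSmoothSectionNear (E := E) F (W b) s x) (p : ℤ) :
    ∀ᶠ y in nhds x, hodgeProj H p y (s y) = R (p, b) y (s y) := by
  filter_upwards [hs] with y hy using hR.hodgeProj_of_mem hy.1

theorem IsHodgeRefinement.diagConn_mem (hflat : IsLocalSystem F V) {b : Bool} {s : ∀ y, V y}
    {x : M} (hs : IsSmoothSectionNear (E := E) F (W b) s x) (v : E) :
    diagConn F R s x v ∈ W b x := by
  refine (hR.mem b x _).2 fun p => ?_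
  rw [hR.family.proj_diagConn, flatConn_congr (hR.section_eq hs p), flatConn_zero hflat,
    LinearMap.zero_apply, map_zero]

variable (hflat : IsLocalSystem F V)
  (hV : IsPolarizedVariation (E := E) F (fun _ => ⊤) H h) [FiniteDimensional ℂ F]
  [IsManifold 𝓘(ℝ, E) ∞ M] {θ : ∀ x, E →ₗ[ℝ] Module.End ℂ (V x)}
  (hθ : ∀ x s v, Sm (E := E) F s x → flatConn F s x v = diagConn F R s x v + θ x v (s x))
include hflat hV hθ

/-- Off the diagonal, `θ` is a block of `∇` itself. Conditions on `∇` acting on sections thereby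
become pointwise conditions on `θ`. -/
theorem IsHodgeRefinement.component_eq {a b : ℤ × Bool} (hab : a ≠ b) (x : M) (v : E) (u : V x) :
    R a x (flatConn F (fun y => R b y (constSection F x u y)) x v) =
      R a x (θ x v (R b x u)) := by
  rw [hR.family.proj_flatConn hflat hθ hab (sm_constSection hflat x u), constSection_self]

/-- The off-diagonal part of the connection changes the Hodge degree by at most one. -/
theorem IsHodgeRefinement.component_degree {a b : ℤ × Bool} (hab : a ≠ b) (h1 : a.1 ≠ b.1 - 1)
    (h2 : a.1 ≠ b.1) (h3 : a.1 ≠ b.1 + 1) (x : M) (v : E) (u : V x) :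
    R a x (θ x v (R b x u)) = 0 := by
  rw [← hR.component_eq hflat hV hθ hab]
  have hs : IsSmoothSectionNear (E := E) F (H b.1)
      (fun y => R b y (constSection F x u y)) x :=
    (hR.family.sm b (sm_constSection hflat x u)).mem (.of_forall fun y => by
      rw [← hR.hodgeProj_proj]; exact hV.hodgeProj_mem _ _ _)
  obtain ⟨h4, h5⟩ := hV.transversal b.1 x _ hs v
  have hker : ∀ q, a.1 ≠ q → H q x ≤ LinearMap.ker (R a x) := fun q hq t ht => by
    rw [LinearMap.mem_ker, ← hR.proj_hodgeProj, hV.hodgeProj_of_mem_ne hq.symm ht, map_zero]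
  rw [← part10_add_part01 (flatConn F _ x) v, map_add]
  have h6 := sup_le (hker _ h1) (hker _ h2) h4
  have h7 := sup_le (hker _ h2) (hker _ h3) h5
  rw [LinearMap.mem_ker] at h6 h7
  rw [h6, h7, add_zero]

/-- The degree-raising part of the connection is of type `(0,1)`. -/
theorem IsHodgeRefinement.component_raising (p : ℤ) (b c : Bool) (x : M) (v : E) (u : V x) :
    R (p + 1, c) x (θ x (Complex.I • v) (R (p, b) x u)) =
      -(Complex.I • R (p + 1, c) x (θ x v (R (p, b) x u))) := by
  have hab : ((p + 1, c) : ℤ × Bool) ≠ (p, b) := by simp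
  rw [← hR.component_eq hflat hV hθ hab, ← hR.component_eq hflat hV hθ hab]
  have hs : IsSmoothSectionNear (E := E) F (H p)
      (fun y => R (p, b) y (constSection F x u y)) x :=
    (hR.family.sm _ (sm_constSection hflat x u)).mem (.of_forall fun y => by
      rw [← hR.hodgeProj_proj]; exact hV.hodgeProj_mem _ _ _)
  -- The (1,0)-part lies in degrees `p - 1` and `p`, so its component in degree `p + 1` vanishes.
  obtain ⟨h4, -⟩ := hV.transversal p x _ hs v
  have hker : ∀ q, p + 1 ≠ q → H q x ≤ LinearMap.ker (R (p + 1, c) x) := fun q hq t ht => by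
    rw [LinearMap.mem_ker, ← hR.proj_hodgeProj, hV.hodgeProj_of_mem_ne hq.symm ht, map_zero]
  have h6 := sup_le (hker _ (by omega)) (hker _ (by omega)) h4
  rw [LinearMap.mem_ker, map_part10] at h6
  exact eq_of_part10_eq_zero h6

theorem IsHodgeRefinement.section_proj (p : ℤ) (b : Bool) (x : M) (u : V x) :
    IsSmoothSectionNear (E := E) F (W b) (fun y => R (p, b) y (constSection F x u y)) x :=
  (hR.family.sm _ (sm_constSection hflat x u)).mem (.of_forall fun y => hR.proj_mem p b y _)

/-- For a holomorphic subbundle, the degree-preserving part of the second fundamental form is of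
type `(1,0)`. -/
theorem IsHodgeRefinement.component_holomorphic {b : Bool}
    (hW : IsGradedHiggsSubbundle (E := E) F H (W b)) (p : ℤ) (x : M) (v : E) (u : V x) :
    R (p, !b) x (θ x (Complex.I • v) (R (p, b) x u)) =
      Complex.I • R (p, !b) x (θ x v (R (p, b) x u)) := by
  have hab : ((p, !b) : ℤ × Bool) ≠ (p, b) := by simp
  have hs := hR.section_proj hflat hV hθ p b x u
  have h1 := (hR.mem b x _).1 (hW.holomorphic x _ hs v) p
  rw [map_part01] at h1
  have h2 : ∀ w, ((R (p, !b) x).restrictScalars ℝ ∘ₗ hodgeConn F H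
      (fun y => R (p, b) y (constSection F x u y)) x) w = R (p, !b) x (θ x w (R (p, b) x u)) := by
    intro w
    change R (p, !b) x (hodgeConn F H _ x w) = _
    rw [hR.proj_hodgeConn hflat hV, ← hR.component_eq hflat hV hθ hab]
    simp only [hR.hodgeProj_proj (p, b)]
  rw [← h2, ← h2]
  exact eq_of_part01_eq_zero h1

/-- For a subbundle preserved by the Higgs field, the second fundamental form does not lower the
degree. -/
theorem IsHodgeRefinement.component_higgs {b : Bool}
    (hW : IsGradedHiggsSubbundle (E := E) F H (W b)) (p : ℤ) (x : M) (v : E) (u : V x) :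
    R (p, !b) x (θ x v (R (p + 1, b) x u)) = 0 := by
  have hab : ((p, !b) : ℤ × Bool) ≠ (p + 1, b) := by simp
  have hs := hR.section_proj hflat hV hθ (p + 1) b x u
  have h1 := (hR.mem b x _).1 (hW.higgs_mem x _ hs v) p
  rw [hR.proj_higgs hflat hV] at h1
  simp only [hR.hodgeProj_proj (p + 1, b)] at h1
  rw [← hR.component_eq hflat hV hθ hab, h1]

end Refinement

/-! ### The Chern connection of `W` and the trace of its curvature. -/

section Chern

variable {E : Type*} [NormedAddCommGroup E] [NormedSpace ℂ E]
  {M : Type*} [TopologicalSpace M] [ChartedSpace E M]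
  {F : Type*} [NormedAddCommGroup F] [NormedSpace ℂ F]
  {V : M → Type*} [∀ x, AddCommGroup (V x)] [∀ x, Module ℂ (V x)] [∀ x, TopologicalSpace (V x)]
  [TopologicalSpace (TotalSpace F V)] [FiberBundle F V] [VectorBundle ℂ F V]
  {H : ℤ → ∀ x, Submodule ℂ (V x)} {h : ∀ x, V x →ₗ[ℂ] V x →ₗ⋆[ℂ] ℂ}
  {R : ℤ × Bool → ∀ x, V x →ₗ[ℂ] V x} {W : Bool → ∀ x, Submodule ℂ (V x)}

/-- The orthogonal projection onto the subbundle with index `b` of a refinement of the Hodge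
decomposition. -/
def blockProj (R : ℤ × Bool → ∀ x, V x →ₗ[ℂ] V x) (b : Bool) (x : M) : V x →ₗ[ℂ] V x :=
  weighted (fun a : ℤ × Bool => if a.2 = b then 1 else 0) R x

section Algebra

variable (hR : IsHodgeRefinement (E := E) h F H R W)
include hR

theorem IsHodgeRefinement.proj_blockProj (a : ℤ × Bool) (b : Bool) (x : M) (u : V x) :
    R a x (blockProj R b x u) = if a.2 = b then R a x u else 0 := by
  rw [blockProj, hR.family.proj_weighted]
  split_ifs <;> simp

theorem IsHodgeRefinement.blockProj_mem (b : Bool) (x : M) (u : V x) : blockProj R b x u ∈ W b x :=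
  (hR.mem b x _).2 fun p => by rw [hR.proj_blockProj]; simp

theorem IsHodgeRefinement.blockProj_of_mem {b : Bool} {x : M} {u : V x} (hu : u ∈ W b x) :
    blockProj R b x u = u := by
  refine hR.family.ext fun a => ?_
  rw [hR.proj_blockProj]
  split_ifs with ha
  · rfl
  · have h1 : a = (a.1, !b) := Prod.ext rfl (by cases h2 : a.2 <;> cases b <;> simp_all)
    rw [h1, (hR.mem b x u).1 hu]

theorem IsHodgeRefinement.blockProj_add (x : M) (u : V x) :
    blockProj R true x u + blockProj R false x u = u := by
  refine hR.family.ext fun a => ?_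
  rw [map_add, hR.proj_blockProj, hR.proj_blockProj]
  cases h2 : a.2 <;> simp

theorem IsHodgeRefinement.blockProj_adj (b : Bool) (x : M) (u t : V x) :
    h x (blockProj R b x u) t = h x u (blockProj R b x t) :=
  hR.family.adj_weighted (fun a => by split_ifs <;> simp) x u t

theorem IsHodgeRefinement.blockProj_idem (b : Bool) (x : M) (u : V x) :
    blockProj R b x (blockProj R b x u) = blockProj R b x u :=
  hR.blockProj_of_mem (hR.blockProj_mem b x u)

theorem IsHodgeRefinement.section_blockProj (hflat : IsLocalSystem F V) (b : Bool) (x : M)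
    (u : V x) : IsSmoothSectionNear (E := E) F (W b)
      (fun y => blockProj R b y (constSection F x u y)) x :=
  Sm.mem (hR.family.sm_weighted hflat _ x _ (sm_constSection hflat x u))
    (.of_forall fun y => hR.blockProj_mem b y _)

theorem IsHodgeRefinement.exists_section (hflat : IsLocalSystem F V) {b : Bool} {x : M}
    {u : V x} (hu : u ∈ W b x) :
    ∃ s : ∀ y, V y, IsSmoothSectionNear (E := E) F (W b) s x ∧ s x = u :=
  ⟨_, hR.section_blockProj hflat b x u, by rw [constSection_self, hR.blockProj_of_mem hu]⟩

end Algebra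

section HodgeMetric

variable [FiniteDimensional ℂ F] (hflat : IsLocalSystem F V)
  (hV : IsPolarizedVariation (E := E) F (fun _ => ⊤) H h)
include hflat hV

theorem IsPolarizedVariation.hodgeSign_hodgeSign (x : M) (u : V x) :
    hodgeSign H x (hodgeSign H x u) = u := by
  refine (hV.isOrthFamily hflat).ext fun p => ?_
  rw [hV.hodgeProj_hodgeSign hflat, hV.hodgeProj_hodgeSign hflat, smul_smul, ← mul_zpow]
  simp

theorem IsPolarizedVariation.hodgeSign_adj (x : M) (u t : V x) :
    h x (hodgeSign H x u) t = h x u (hodgeSign H x t) :=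
  (hV.isOrthFamily hflat).adj_weighted (c := fun p => (-1 : ℂ) ^ p) (fun p => by simp) x u t

theorem IsPolarizedVariation.hodgeMetric_herm (x : M) (u t : V x) :
    hodgeMetric H h x u t = (starRingEnd ℂ) (hodgeMetric H h x t u) := by
  change h x (hodgeSign H x u) t = (starRingEnd ℂ) (h x (hodgeSign H x t) u)
  rw [hV.hodgeSign_adj hflat, hV.herm]

theorem IsPolarizedVariation.hodgeMetric_pos (x : M) (u : V x) (hu : u ≠ 0) :
    0 < (hodgeMetric H h x u u).re := by
  have hP := hV.isOrthFamily hflat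
  obtain ⟨I, hI⟩ := hP.exists_finset x
  have h1 : hodgeMetric H h x u u =
      ∑ p ∈ I, (-1 : ℂ) ^ p * h x (hodgeProj H p x u) (hodgeProj H p x u) := by
    change h x (hodgeSign H x u) u = _
    rw [hodgeSign_apply hI, map_sum, LinearMap.sum_apply]
    refine Finset.sum_congr rfl fun p _ => ?_
    rw [map_smul, LinearMap.smul_apply, smul_eq_mul, ← hP.adj, hP.idem]
  have h2 : ∀ p, 0 ≤ ((-1 : ℂ) ^ p * h x (hodgeProj H p x u) (hodgeProj H p x u)).re := fun p => by
    by_cases h0 : hodgeProj H p x u = 0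
    · simp [h0]
    · exact (hV.positive x p _ (hV.hodgeProj_mem p x u) h0).le
  rw [h1, Complex.re_sum]
  refine lt_of_le_of_ne (Finset.sum_nonneg fun p _ => h2 p) fun h3 => hu ?_
  rw [eq_comm, Finset.sum_eq_zero_iff_of_nonneg fun p _ => h2 p] at h3
  refine hP.ext fun p => ?_
  rw [map_zero]
  by_cases hp : p ∈ I
  · by_contra h0
    exact (hV.positive x p _ (hV.hodgeProj_mem p x u) h0).ne' (h3 p hp)
  · rw [hI p hp, LinearMap.zero_apply]

end HodgeMetric

variable (hR : IsHodgeRefinement (E := E) h F H R W) (hflat : IsLocalSystem F V)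
  (hV : IsPolarizedVariation (E := E) F (fun _ => ⊤) H h) [FiniteDimensional ℂ F]
  [IsManifold 𝓘(ℝ, E) ∞ M]
include hR hflat hV

theorem IsHodgeRefinement.realDeriv_hodgeMetric {s t : ∀ y, V y} {x : M}
    (hs : Sm (E := E) F s x) (ht : Sm (E := E) F t x) (v : E) :
    realDeriv (fun y => hodgeMetric H h y (s y) (t y)) x v =
      hodgeMetric H h x (diagConn F R s x v) (t x) +
        hodgeMetric H h x (s x) (diagConn F R t x v) := by
  have h1 := (hV.isFlatHermitian hflat).realDeriv_weighted hR.family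
    (fun a : ℤ × Bool => (-1 : ℂ) ^ a.1) hs ht v
  simp only [← hR.hodgeSign_eq hflat hV] at h1
  exact h1

/-- In the blocks of `W b` the two connections agree, because a section of `W b` has the same
components for `H` and for `R`. In the other blocks `diagConn` vanishes, and the (0,1)-part of
`hodgeConn` does so by holomorphy. -/
theorem IsHodgeRefinement.part01_diagConn {b : Bool}
    (hW : IsGradedHiggsSubbundle (E := E) F H (W b)) {s : ∀ y, V y} {x : M}
    (hs : IsSmoothSectionNear (E := E) F (W b) s x) (v : E) :
    part01 (diagConn F R s x) v = part01 (hodgeConn F H s x) v := by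
  refine hR.family.ext fun a => ?_
  by_cases ha : a.2 = b
  · rw [map_part01, map_part01]
    congr 1
    ext w
    change R a x (diagConn F R s x w) = R a x (hodgeConn F H s x w)
    rw [hR.proj_hodgeConn hflat hV, hR.family.proj_diagConn, flatConn_congr
      (hR.hodgeProj_section hs a.1), ← ha]
  · have h1 : a = (a.1, !b) := Prod.ext rfl (by cases h2 : a.2 <;> cases b <;> simp_all)
    rw [h1, (hR.mem b x _).1 (hW.holomorphic x s hs v)]
    rw [part01, map_smul, map_add, map_smul, (hR.mem b x _).1 (hR.diagConn_mem hflat hs _),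
      (hR.mem b x _).1 (hR.diagConn_mem hflat hs _)]
    simp

/-- The Chern connection is the part of the flat connection which preserves the refined
decomposition. -/
theorem IsHodgeRefinement.isChernConnection {b : Bool}
    (hW : IsGradedHiggsSubbundle (E := E) F H (W b)) :
    IsChernConnection F H h (W b) (diagConn (E := E) F R) where
  smooth x s hs v := by
    refine Sm.mem (hR.family.sm_diagNabla hflat hs.sm v) ?_
    filter_upwards [hs.eventually] with y hy
    exact hR.diagConn_mem hflat hy _
  add x s t hs ht := hR.family.diagConn_add hflat hs.sm ht.sm
  leibniz x f s hf hs v := hR.family.diagConn_smul hflat hf hs.sm v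
  metric x s t hs ht v := hR.realDeriv_hodgeMetric hflat hV hs.sm ht.sm v
  dbar x s hs v := hR.part01_diagConn hflat hV hW hs v

/-- Uniqueness of the Chern connection. -/
theorem IsHodgeRefinement.chernConnection_eq {b : Bool}
    (hW : IsGradedHiggsSubbundle (E := E) F H (W b)) {D : (∀ x, V x) → ∀ x, E →ₗ[ℝ] V x}
    (hD : IsChernConnection F H h (W b) D) {s : ∀ y, V y} {x : M}
    (hs : IsSmoothSectionNear (E := E) F (W b) s x) : D s x = diagConn F R s x := by
  let δ : (∀ y, V y) → E →ₗ[ℝ] V x := fun s => D s x - diagConn F R s x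
  have hδ : ∀ t : ∀ y, V y, IsSmoothSectionNear (E := E) F (W b) t x → ∀ v,
      δ t (Complex.I • v) = Complex.I • δ t v := by
    intro t ht v
    apply eq_of_part01_eq_zero
    have h1 := hD.dbar x t ht v
    rw [← hR.part01_diagConn hflat hV hW ht v] at h1
    rw [← sub_eq_zero] at h1
    rw [← h1]
    simp only [part01, δ, LinearMap.sub_apply]
    module
  have hskew : ∀ t : ∀ y, V y, IsSmoothSectionNear (E := E) F (W b) t x → ∀ v,
      hodgeMetric H h x (δ s v) (t x) = - hodgeMetric H h x (s x) (δ t v) := by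
    intro t ht v
    have h1 := hD.metric x s t hs ht v
    rw [hR.realDeriv_hodgeMetric hflat hV hs.sm ht.sm] at h1
    simp only [δ, LinearMap.sub_apply, map_sub]
    linear_combination -h1
  have hmem : ∀ v, δ s v ∈ W b x := by
    intro v
    refine Submodule.sub_mem _ ?_ (hR.diagConn_mem hflat hs v)
    have := (hD.smooth x s hs v).self_of_nhds.1
    simpa only [coordField_self] using this
  ext v
  rw [← sub_eq_zero]
  by_contra hne
  -- The difference `δ` is skew for the metric and complex linear in the tangent vector. Comparing
  -- skewness at `v` and at `i v`, against a section `t` with value `δ s v` at `x`, gives a number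
  -- equal to its own negative.
  have h0 : hodgeMetric H h x (δ s v) (δ s v) = 0 := by
    obtain ⟨t, ht, htx⟩ := hR.exists_section hflat (hmem v)
    have h1 := hskew t ht v
    have h2 := hskew t ht (Complex.I • v)
    rw [hδ s hs, hδ t ht, map_smul, LinearMap.smul_apply, LinearMap.map_smulₛₗ, Complex.conj_I,
      smul_eq_mul, smul_eq_mul] at h2
    have h3 : Complex.I * hodgeMetric H h x (δ s v) (t x) =
        Complex.I * -hodgeMetric H h x (δ s v) (t x) := by
      linear_combination h2 + Complex.I * h1
    have h4 := mul_left_cancel₀ Complex.I_ne_zero h3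
    rw [htx] at h4
    exact self_eq_neg.1 h4
  have h5 := hV.hodgeMetric_pos hflat x (δ s v) hne
  rw [h0] at h5
  exact lt_irrefl _ h5

variable {θ : ∀ x, E →ₗ[ℝ] Module.End ℂ (V x)}
  (hθ : ∀ x s v, Sm (E := E) F s x → flatConn F s x v = diagConn F R s x v + θ x v (s x))
include hθ

/-- The curvature is written down directly as the block-diagonal part of `θ_w θ_v - θ_v θ_w`,
restricted to `W b`. -/
theorem IsHodgeRefinement.exists_isCurvature (b : Bool) :
    ∃ Ω : ∀ x, E →ₗ[ℝ] E →ₗ[ℝ] Module.End ℂ (W b x),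
      IsCurvature F (W b) (diagConn F R) Ω := by
  choose I hI using fun x => hR.family.exists_finset x
  let q : ∀ x, V x →ₗ[ℂ] W b x := fun x =>
    (blockProj R b x).codRestrict (W b x) (hR.blockProj_mem b x)
  let K : ∀ x, Module.End ℂ (V x) →ₗ[ℝ] Module.End ℂ (W b x) := fun x =>
    { toFun := fun X => q x ∘ₗ (∑ a ∈ I x, R a x ∘ₗ X ∘ₗ R a x) ∘ₗ (W b x).subtype
      map_add' := fun X Y => by
        rw [← LinearMap.comp_add, ← LinearMap.add_comp, ← Finset.sum_add_distrib]
        simp only [LinearMap.comp_add, LinearMap.add_comp]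
      map_smul' := fun c X => by
        ext u
        simp [Finset.smul_sum] }
  let Ω : ∀ x, E →ₗ[ℝ] E →ₗ[ℝ] Module.End ℂ (W b x) := fun x =>
    LinearMap.mk₂ ℝ (fun v w => K x (θ x w * θ x v - θ x v * θ x w))
      (fun v v' w => by
        rw [← map_add]; congr 1; rw [map_add, mul_add, add_mul]; abel)
      (fun c v w => by
        rw [← map_smul]; congr 1; rw [map_smul, mul_smul_comm, smul_mul_assoc, smul_sub])
      (fun v w w' => by
        rw [← map_add]; congr 1; rw [map_add, mul_add, add_mul]; abel)
      (fun c v w => by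
        rw [← map_smul]; congr 1; rw [map_smul, mul_smul_comm, smul_mul_assoc, smul_sub])
  refine ⟨Ω, fun x s hs v w u hu => ?_⟩
  have hmem : ∀ v w : E, diagConn F R (diagNabla F R x w s) x v ∈ W b x := fun v w =>
    hR.diagConn_mem hflat ((Sm.mem (hR.family.sm_diagNabla hflat hs.sm w) (by
      filter_upwards [hs.eventually] with y hy
      exact hR.diagConn_mem hflat hy _))) v
  change blockProj R b x ((∑ a ∈ I x, R a x ∘ₗ (θ x w * θ x v - θ x v * θ x w) ∘ₗ R a x) u) = _
  have h1 : diagConn F R (diagNabla F R x w s) x v - diagConn F R (diagNabla F R x v s) x w =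
      (∑ a ∈ I x, R a x ∘ₗ (θ x w * θ x v - θ x v * θ x w) ∘ₗ R a x) (s x) := by
    refine hR.family.ext fun a => ?_
    rw [hR.family.curvature hflat hθ a hs.sm, LinearMap.sum_apply]
    have h2 := hR.family.proj_sum (hI x) a
      fun a => (θ x w * θ x v - θ x v * θ x w) (R a x (s x))
    exact h2.symm
  rw [hu, ← h1]
  exact hR.blockProj_of_mem (Submodule.sub_mem _ (hmem v w) (hmem w v))

/-- The trace of the curvature of the Chern connection in terms of the second fundamental forms of
`W` and of its orthogonal complement in the flat bundle. -/
theorem IsHodgeRefinement.trace_curvature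
    {Ω : ∀ x, E →ₗ[ℝ] E →ₗ[ℝ] Module.End ℂ (W true x)}
    (hΩ : IsCurvature F (W true) (diagConn F R) Ω) (x : M) (v w : E) :
    LinearMap.trace ℂ (W true x) (Ω x v w) =
      LinearMap.trace ℂ (V x) ((blockProj R true x * θ x w * blockProj R false x) *
        (blockProj R false x * θ x v * blockProj R true x)) -
      LinearMap.trace ℂ (V x) ((blockProj R true x * θ x v * blockProj R false x) *
        (blockProj R false x * θ x w * blockProj R true x)) := by
  have hfin : FiniteDimensional ℂ (V x) := finiteDimensional_fiber (F := F) x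
  obtain ⟨I, hI⟩ := hR.family.exists_finset x
  let P : Module.End ℂ (V x) := blockProj R true x
  let P' : Module.End ℂ (V x) := blockProj R false x
  have hPP' : P + P' = 1 := LinearMap.ext fun u => hR.blockProj_add x u
  have hP : P * P = P := LinearMap.ext fun u => hR.blockProj_idem true x u
  have hP' : P' * P' = P' := LinearMap.ext fun u => hR.blockProj_idem false x u
  let X : Module.End ℂ (V x) := θ x w * θ x v - θ x v * θ x w
  let q : V x →ₗ[ℂ] W true x := LinearMap.codRestrict (W true x) P (hR.blockProj_mem true x)
  have hq : q ∘ₗ (W true x).subtype = LinearMap.id :=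
    LinearMap.ext fun u => Subtype.ext (hR.blockProj_of_mem u.2)
  -- The curvature is extended by zero to `V x`. Under the trace the outer `R a x` then merges with
  -- the inner one by cyclicity, and the sum over blocks collapses to `X * P`.
  have h1 : (W true x).subtype ∘ₗ Ω x v w ∘ₗ q = ∑ a ∈ I, (R a x : Module.End ℂ (V x)) * (X *
      ((R a x : Module.End ℂ (V x)) * P)) := by
    ext u
    refine hR.family.ext fun a => ?_
    have hs := hR.section_blockProj hflat true x u
    have h2 := hΩ x _ hs v w (q u) (by rw [constSection_self]; rfl)
    rw [LinearMap.sum_apply]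
    have h3 := hR.family.curvature hflat hθ a hs.sm v w
    rw [constSection_self] at h3
    have h4 := hR.family.proj_sum hI a fun a => X (R a x (P u))
    exact (congrArg (R a x) h2).trans (h3.trans h4.symm)
  have h2 : LinearMap.trace ℂ (W true x) (Ω x v w) = LinearMap.trace ℂ (V x) (X * P) := by
    calc LinearMap.trace ℂ (W true x) (Ω x v w)
        = LinearMap.trace ℂ (W true x) ((Ω x v w ∘ₗ q) ∘ₗ (W true x).subtype) := by
          rw [LinearMap.comp_assoc, hq, LinearMap.comp_id]
      _ = LinearMap.trace ℂ (V x) ((W true x).subtype ∘ₗ Ω x v w ∘ₗ q) :=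
          LinearMap.trace_comp_comm' _ _
      _ = ∑ a ∈ I, LinearMap.trace ℂ (V x) (X * ((R a x : Module.End ℂ (V x)) * P)) := by
          rw [h1, map_sum]
          refine Finset.sum_congr rfl fun a _ => ?_
          rw [LinearMap.trace_mul_comm, mul_assoc, mul_assoc]
          congr 2
          ext u
          change R a x (P (R a x u)) = R a x (P u)
          simp only [P, hR.proj_blockProj, hR.family.idem]
      _ = LinearMap.trace ℂ (V x) (X * P) := by
          rw [← map_sum, ← Finset.mul_sum, ← Finset.sum_mul]
          congr 2
          ext u
          rw [Module.End.mul_apply, LinearMap.sum_apply, hR.family.sum_eq hI]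
  -- Insert `1 = P + P'` between `A` and `B`. The first term is symmetric in `A` and `B` by
  -- cyclicity, hence drops out of the commutator.
  have key : ∀ A B : Module.End ℂ (V x), LinearMap.trace ℂ (V x) (A * B * P) =
      LinearMap.trace ℂ (V x) (A * P * (B * P)) +
        LinearMap.trace ℂ (V x) ((P * A * P') * (P' * B * P)) := by
    intro A B
    have h3 : LinearMap.trace ℂ (V x) ((P * A * P') * (P' * B * P)) =
        LinearMap.trace ℂ (V x) (A * P' * (B * P)) := by
      rw [mul_assoc P, mul_assoc P, LinearMap.trace_mul_comm]
      congr 1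
      calc A * P' * (P' * B * P) * P = A * (P' * P') * B * (P * P) := by noncomm_ring
        _ = A * P' * (B * P) := by rw [hP, hP']; noncomm_ring
    rw [h3, ← map_add, ← add_mul, ← mul_add, hPP', mul_one, mul_assoc]
  rw [h2]
  change LinearMap.trace ℂ (V x) ((θ x w * θ x v - θ x v * θ x w) * P) = _
  rw [sub_mul, map_sub, key, key, LinearMap.trace_mul_comm ℂ (θ x w * P)]
  exact add_sub_add_left_eq_sub _ _ _

end Chern

/-! ### Second fundamental form, vanishing of the Chern form, and the splitting. -/

section Splitting

variable {E : Type*} [NormedAddCommGroup E] [NormedSpace ℂ E]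
  {M : Type*} [TopologicalSpace M] [ChartedSpace E M]
  {F : Type*} [NormedAddCommGroup F] [NormedSpace ℂ F]
  {V : M → Type*} [∀ x, AddCommGroup (V x)] [∀ x, Module ℂ (V x)] [∀ x, TopologicalSpace (V x)]
  [TopologicalSpace (TotalSpace F V)] [FiberBundle F V] [VectorBundle ℂ F V]
  {H : ℤ → ∀ x, Submodule ℂ (V x)} {h : ∀ x, V x →ₗ[ℂ] V x →ₗ⋆[ℂ] ℂ}
  {R : ℤ × Bool → ∀ x, V x →ₗ[ℂ] V x} {W : Bool → ∀ x, Submodule ℂ (V x)}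
  {θ : ∀ x, E →ₗ[ℝ] Module.End ℂ (V x)}

/-- The block of an endomorphism-valued one-form which maps the subbundle with index `c` to the
one with index `b`. -/
def offBlock (R : ℤ × Bool → ∀ x, V x →ₗ[ℂ] V x) (θ : ∀ x, E →ₗ[ℝ] Module.End ℂ (V x))
    (b c : Bool) (x : M) (v : E) : Module.End ℂ (V x) :=
  blockProj R b x * θ x v * blockProj R c x

variable (hR : IsHodgeRefinement (E := E) h F H R W)
include hR

theorem IsHodgeRefinement.end_ext {x : M} {A B : Module.End ℂ (V x)}
    (hAB : ∀ a d u, R a x (A (R d x u)) = R a x (B (R d x u))) : A = B := by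
  ext u
  obtain ⟨I, hI⟩ := hR.family.exists_finset x
  rw [← hR.family.sum_eq hI u, map_sum, map_sum]
  exact Finset.sum_congr rfl fun d _ => hR.family.ext fun a => hAB a d u

theorem IsHodgeRefinement.blockProj_proj (a : ℤ × Bool) (b : Bool) (x : M) (u : V x) :
    blockProj R b x (R a x u) = if a.2 = b then R a x u else 0 := by
  rw [blockProj, hR.family.weighted_proj]
  split_ifs <;> simp

theorem IsHodgeRefinement.proj_offBlock (b c : Bool) (a d : ℤ × Bool) (x : M) (v : E) (u : V x) :
    R a x (offBlock R θ b c x v (R d x u)) =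
      if a.2 = b ∧ d.2 = c then R a x (θ x v (R d x u)) else 0 := by
  change R a x (blockProj R b x (θ x v (blockProj R c x (R d x u)))) = _
  rw [hR.proj_blockProj, hR.blockProj_proj]
  by_cases h1 : a.2 = b <;> by_cases h2 : d.2 = c <;> simp [h1, h2]

theorem IsHodgeRefinement.offBlock_adj (hskew : ∀ x v u t, h x (θ x v u) t = - h x u (θ x v t))
    (b c : Bool) (x : M) (v : E) (u t : V x) :
    h x (offBlock R θ b c x v u) t = - h x u (offBlock R θ c b x v t) := by
  change h x (blockProj R b x (θ x v (blockProj R c x u))) t =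
    - h x u (blockProj R c x (θ x v (blockProj R b x t)))
  rw [hR.blockProj_adj, hskew, hR.blockProj_adj]

variable (hflat : IsLocalSystem F V)
  (hV : IsPolarizedVariation (E := E) F (fun _ => ⊤) H h) [FiniteDimensional ℂ F]

include hflat hV

theorem IsHodgeRefinement.hodgeSign_proj (a : ℤ × Bool) (x : M) (u : V x) :
    hodgeSign H x (R a x u) = (-1 : ℂ) ^ a.1 • R a x u := by
  refine hR.family.ext fun b => ?_
  rw [hR.proj_hodgeSign hflat hV, map_smul]
  by_cases hb : b = a
  · rw [hb]
  · rw [hR.family.ortho b a hb, smul_zero, smul_zero]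

variable [IsManifold 𝓘(ℝ, E) ∞ M]
  (hθ : ∀ x s v, Sm (E := E) F s x → flatConn F s x v = diagConn F R s x v + θ x v (s x))

section FirstChernForm

variable (hW : IsGradedHiggsSubbundle (E := E) F H (W true))
include hW

theorem IsHodgeRefinement.exists_isFirstChernForm
    (hθ : ∀ x s v, Sm (E := E) F s x → flatConn F s x v = diagConn F R s x v + θ x v (s x)) :
    ∃ γ : M → E →ₗ[ℝ] E →ₗ[ℝ] ℂ, IsFirstChernForm F H h (W true) γ := by
  obtain ⟨Ω, hΩ⟩ := hR.exists_isCurvature hflat hV hθ true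
  exact ⟨fun x => (Ω x).compr₂ (((Complex.I / (2 * Real.pi)) •
    LinearMap.trace ℂ (W true x)).restrictScalars ℝ), _, Ω, hR.isChernConnection hflat hV hW, hΩ,
    fun x v w => rfl⟩

include hθ

/-- The right-hand side involves neither the Chern connection nor its curvature, so this also gives
uniqueness of `γ`. -/
theorem IsHodgeRefinement.firstChernForm_eq {γ : M → E →ₗ[ℝ] E →ₗ[ℝ] ℂ}
    (hγ : IsFirstChernForm F H h (W true) γ) (x : M) (v w : E) :
    γ x v w = Complex.I / (2 * Real.pi) *
      (LinearMap.trace ℂ (V x) (offBlock R θ true false x w * offBlock R θ false true x v) -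
        LinearMap.trace ℂ (V x) (offBlock R θ true false x v * offBlock R θ false true x w)) := by
  obtain ⟨D, Ω, hD, hΩ, hγ⟩ := hγ
  have hΩ' : IsCurvature F (W true) (diagConn F R) Ω := by
    intro x s hs v w u hu
    have key : ∀ v w : E, D (fun y => D s y (coordField x w y)) x v =
        diagConn F R (fun y => diagConn F R s y (coordField x w y)) x v := by
      intro v w
      rw [hR.chernConnection_eq hflat hV hW hD (hD.smooth x s hs w)]
      -- The inner derivative is differentiated again, so agreement with `diagConn` is needed on a
      -- neighbourhood.
      refine congrArg (fun L : E →ₗ[ℝ] V x => L v) (diagConn_congr (E := E) (F := F) (P := R) ?_)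
      filter_upwards [hs.eventually] with y hy
      rw [hR.chernConnection_eq hflat hV hW hD hy]
    rw [hΩ x s hs v w u hu, key, key]
  rw [hγ, hR.trace_curvature hflat hV hθ hΩ']
  rfl

/-- The sign `(-1)^(p+q)` is the scalar by which conjugation with `hodgeSign` acts on this block, so
parity determines type: holomorphy settles `p = q`, transversality `p = q + 1`, and every other
block is zero, by the Higgs condition when `q = p + 1`. -/
theorem IsHodgeRefinement.component_type (p q : ℤ) (x : M) (v : E) (u : V x) :
    (((-1 : ℂ) ^ p * (-1) ^ q = 1 ∧ R (p, false) x (θ x (Complex.I • v) (R (q, true) x u)) =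
        Complex.I • R (p, false) x (θ x v (R (q, true) x u))) ∨
      ((-1 : ℂ) ^ p * (-1) ^ q = -1 ∧ R (p, false) x (θ x (Complex.I • v) (R (q, true) x u)) =
        -(Complex.I • R (p, false) x (θ x v (R (q, true) x u))))) ∨
      (R (p, false) x (θ x (Complex.I • v) (R (q, true) x u)) = 0 ∧
        R (p, false) x (θ x v (R (q, true) x u)) = 0) := by
  have h1 : ((-1 : ℂ) ^ q * (-1) ^ q) = 1 := by rw [← mul_zpow]; simp
  by_cases hpq : p = q
  · subst hpq
    exact .inl (.inl ⟨h1, hR.component_holomorphic hflat hV hθ hW p x v u⟩)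
  by_cases hpq1 : p = q + 1
  · subst hpq1
    refine .inl (.inr ⟨?_, hR.component_raising hflat hV hθ q true false x v u⟩)
    rw [zpow_add_one₀ (by norm_num), mul_right_comm, h1, one_mul]
  refine .inr ?_
  by_cases hpq2 : q = p + 1
  · subst hpq2
    exact ⟨hR.component_higgs hflat hV hθ hW p x _ u, hR.component_higgs hflat hV hθ hW p x _ u⟩
  have h2 : ((p, false) : ℤ × Bool) ≠ (q, true) := by simp
  have h3 : ∀ v, R (p, false) x (θ x v (R (q, true) x u)) = 0 := fun v =>
    hR.component_degree hflat hV hθ h2 (by simp; omega) hpq hpq1 x v u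
  exact ⟨h3 _, h3 _⟩

theorem IsHodgeRefinement.firstChernForm_properties
    (hskew : ∀ x v u t, h x (θ x v u) t = - h x u (θ x v t)) {γ : M → E →ₗ[ℝ] E →ₗ[ℝ] ℂ}
    (hγ : IsFirstChernForm F H h (W true) γ) (x : M) (v w : E) :
    (γ x v w).im = 0 ∧ γ x w v = -γ x v w ∧
      γ x (Complex.I • v) (Complex.I • w) = γ x v w ∧ (γ x v (Complex.I • v)).re ≤ 0 ∧
      (γ x v (Complex.I • v) = 0 → offBlock R θ false true x v = 0) := by
  have hfin : FiniteDimensional ℂ (V x) := finiteDimensional_fiber (F := F) x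
  have hconj : ∀ (A : Module.End ℂ (V x)) (a d : ℤ × Bool) (u : V x),
      R a x ((hodgeSign H x * A * hodgeSign H x : Module.End ℂ (V x)) (R d x u)) =
        ((-1 : ℂ) ^ a.1 * (-1) ^ d.1) • R a x (A (R d x u)) := by
    intro A a d u
    change R a x (hodgeSign H x (A (hodgeSign H x (R d x u)))) = _
    rw [hR.hodgeSign_proj hflat hV, hR.proj_hodgeSign hflat hV, map_smul, map_smul, smul_smul]
  refine trace_secondFundamentalForm (g := hodgeMetric H h x) (ε := hodgeSign H x)
    (N := offBlock R θ false true x) (N' := offBlock R θ true false x) (Φ := fun v w => γ x v w)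
    (hV.hodgeMetric_herm hflat x) (hV.hodgeMetric_pos hflat x)
    (LinearMap.ext (hV.hodgeSign_hodgeSign hflat x)) ?_ ?_ ?_ ?_
    (hR.firstChernForm_eq hflat hV hθ hW hγ x) v w
  · intro u t
    exact hV.hodgeSign_adj hflat x _ t
  · intro v u t
    change h x (hodgeSign H x (hodgeSign H x _)) t = - h x (hodgeSign H x (hodgeSign H x u)) _
    rw [hV.hodgeSign_hodgeSign hflat, hV.hodgeSign_hodgeSign hflat, hR.offBlock_adj hskew]
  · intro v
    refine hR.end_ext fun a d u => ?_
    simp only [LinearMap.add_apply, LinearMap.smul_apply, map_add, map_smul, hconj,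
      hR.proj_offBlock]
    obtain ⟨p, b⟩ := a
    obtain ⟨q, c⟩ := d
    split_ifs with hbc
    · obtain ⟨rfl, rfl⟩ := hbc
      rcases hR.component_type hflat hV hθ hW p q x v u with (⟨h1, h2⟩ | ⟨h1, h2⟩) | ⟨h1, h2⟩
      · rw [h1, h2, one_smul, one_smul, smul_add]
      · rw [h1]; simp
      · rw [h1, h2]; simp
    · simp
  · intro v
    refine hR.end_ext fun a d u => ?_
    simp only [LinearMap.sub_apply, LinearMap.neg_apply, LinearMap.smul_apply, map_sub, map_neg,
      map_smul, hconj, hR.proj_offBlock]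
    obtain ⟨p, b⟩ := a
    obtain ⟨q, c⟩ := d
    split_ifs with hbc
    · obtain ⟨rfl, rfl⟩ := hbc
      rcases hR.component_type hflat hV hθ hW p q x v u with (⟨h1, h2⟩ | ⟨h1, h2⟩) | ⟨h1, h2⟩
      · rw [h1]; simp
      · rw [h1, h2]; module
      · rw [h1, h2]; simp
    · simp

/-- If the orthogonal complement is also a graded Higgs subbundle, the second fundamental form
vanishes. -/
theorem IsHodgeRefinement.offBlock_eq_zero
    (hskew : ∀ x v u t, h x (θ x v u) t = - h x u (θ x v t))
    (hW' : IsGradedHiggsSubbundle (E := E) F H (W false)) (x : M) (v : E) :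
    offBlock R θ false true x v = 0 := by
  have hh := hV.isFlatHermitian hflat
  have hadj : ∀ (p q : ℤ) (v : E) (u t : V x), h x (R (p, false) x (θ x v (R (q, true) x u))) t =
      - h x u (R (q, true) x (θ x v (R (p, false) x t))) := by
    intro p q v u t
    rw [hR.family.adj, hskew, hR.family.adj]
  refine hR.end_ext fun a d u => ?_
  rw [hR.proj_offBlock, LinearMap.zero_apply, map_zero]
  obtain ⟨p, b⟩ := a
  obtain ⟨q, c⟩ := d
  split_ifs with hbc
  swap
  · rfl
  obtain ⟨rfl, rfl⟩ := hbc
  have h2 : ((p, false) : ℤ × Bool) ≠ (q, true) := by simp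
  by_cases hpq : p = q
  · subst hpq
    refine hh.nondeg x _ fun t => ?_
    -- This block and its adjoint are both complex linear in `v`, by holomorphy of `W` and of `W'`.
    -- But adjunction conjugates the factor `i`, so both vanish.
    have h3 := hadj p p (Complex.I • v) u t
    have h4 : R (p, true) x (θ x (Complex.I • v) (R (p, false) x t)) =
        Complex.I • R (p, true) x (θ x v (R (p, false) x t)) :=
      hR.component_holomorphic hflat hV hθ hW' p x v t
    have h5 : R (p, false) x (θ x (Complex.I • v) (R (p, true) x u)) =
        Complex.I • R (p, false) x (θ x v (R (p, true) x u)) :=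
      hR.component_holomorphic hflat hV hθ hW p x v u
    rw [h4, h5, map_smul, LinearMap.smul_apply, LinearMap.map_smulₛₗ, Complex.conj_I, smul_eq_mul,
      smul_eq_mul] at h3
    have h6 := hadj p p v u t
    have h7 : (2 * Complex.I) * h x (R (p, false) x (θ x v (R (p, true) x u))) t = 0 := by
      linear_combination h3 + Complex.I * h6
    exact (mul_eq_zero.1 h7).resolve_left (by simp)
  by_cases hpq1 : p = q + 1
  · subst hpq1
    refine hh.nondeg x _ fun t => ?_
    -- The raising block from `W` to `W'` is minus the adjoint of the lowering block from `W'` to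
    -- `W`, which is part of the Higgs field.
    have h3 : R (q, true) x (θ x v (R (q + 1, false) x t)) = 0 :=
      hR.component_higgs hflat hV hθ hW' q x v t
    rw [hadj, h3, map_zero, neg_zero]
  by_cases hpq2 : q = p + 1
  · subst hpq2
    exact hR.component_higgs hflat hV hθ hW p x v u
  exact hR.component_degree hflat hV hθ h2 (by simp; omega) hpq hpq1 x v u

end FirstChernForm

theorem IsHodgeRefinement.offBlock_swap_eq_zero
    (hskew : ∀ x v u t, h x (θ x v u) t = - h x u (θ x v t)) {b c : Bool} {x : M} {v : E}
    (h0 : offBlock R θ b c x v = 0) : offBlock R θ c b x v = 0 := by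
  ext u
  refine (hV.isFlatHermitian hflat).nondeg x _ fun t => ?_
  rw [hR.offBlock_adj hskew, h0, LinearMap.zero_apply, map_zero, neg_zero]

include hθ

/-- If the second fundamental form vanishes, the flat connection preserves the subbundle. -/
theorem IsHodgeRefinement.flatConn_mem {b : Bool} (h0 : ∀ x v, offBlock R θ (!b) b x v = 0)
    {s : ∀ y, V y} {x : M} (hs : IsSmoothSectionNear (E := E) F (W b) s x) (v : E) :
    flatConn F s x v ∈ W b x := by
  rw [hθ x s v hs.sm]
  refine Submodule.add_mem _ (hR.diagConn_mem hflat hs v) ((hR.mem b x _).2 fun p => ?_)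
  have h1 := congrArg (fun A : Module.End ℂ (V x) => R (p, !b) x (A (s x))) (h0 x v)
  change R (p, !b) x (blockProj R (!b) x (θ x v (blockProj R b x (s x)))) = R (p, !b) x 0 at h1
  rw [hR.blockProj_of_mem hs.self_of_nhds.1, hR.proj_blockProj, if_pos rfl, map_zero] at h1
  exact h1

omit hθ

theorem IsHodgeRefinement.proj_mem_inf (p : ℤ) (b : Bool) (x : M) (u : V x) :
    R (p, b) x u ∈ W b x ⊓ H p x :=
  ⟨hR.proj_mem p b x u, by rw [← hR.hodgeProj_proj]; exact hV.hodgeProj_mem _ _ _⟩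

theorem IsHodgeRefinement.proj_of_mem_inf {p : ℤ} {b : Bool} {x : M} {u : V x}
    (hu : u ∈ W b x ⊓ H p x) : R (p, b) x u = u := by
  rw [← hR.hodgeProj_of_mem hu.1, hV.hodgeProj_of_mem hu.2]

theorem IsHodgeRefinement.subbundle_inf (p : ℤ) (b : Bool) :
    IsSmoothSubbundle (E := E) F fun x => W b x ⊓ H p x :=
  isSmoothSubbundle_of_projection hflat (hR.family.smooth (p, b))
    (hR.proj_mem_inf hflat hV p b) fun _ _ hu => hR.proj_of_mem_inf hflat hV hu

theorem IsHodgeRefinement.section_hodgeProj {b : Bool} {s : ∀ y, V y} {x : M}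
    (hs : IsSmoothSectionNear (E := E) F (W b) s x) (p : ℤ) :
    IsSmoothSectionNear (E := E) F (W b) (fun y => hodgeProj H p y (s y)) x := by
  refine Sm.mem (hV.smoothEnd_hodgeProj hflat p x s hs.sm) ?_
  filter_upwards [hR.hodgeProj_section hs p] with y hy
  rw [hy]
  exact hR.proj_mem p b y _

include hθ

/-- The operators `D` and `σ` are made of Hodge components of `∇` applied to Hodge components of
sections; both operations preserve `W b` once `∇` does. -/
theorem IsHodgeRefinement.isGradedHiggsSubbundle {b : Bool}
    (h0 : ∀ x v, offBlock R θ (!b) b x v = 0) :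
    IsGradedHiggsSubbundle (E := E) F H (W b) where
  graded x := hR.graded b x fun p u => hV.hodgeProj_mem p x u
  subbundle p := hR.subbundle_inf hflat hV p b
  holomorphic x s hs v := by
    have h1 : ∀ v, hodgeConn F H s x v ∈ W b x := fun v => by
      refine (hR.mem b x _).2 fun p => ?_
      rw [hR.proj_hodgeConn hflat hV]
      exact (hR.mem b x _).1 (hR.flatConn_mem hflat hV hθ h0
        (hR.section_hodgeProj hflat hV hs p) v) p
    exact Submodule.smul_mem _ _ (Submodule.add_mem _ (h1 v) (Submodule.smul_mem _ _ (h1 _)))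
  higgs_mem x s hs v := by
    refine (hR.mem b x _).2 fun p => ?_
    rw [hR.proj_higgs hflat hV]
    exact (hR.mem b x _).1 (hR.flatConn_mem hflat hV hθ h0
      (hR.section_hodgeProj hflat hV hs (p + 1)) v) p

theorem IsHodgeRefinement.isPolarizedVariation {b : Bool}
    (h0 : ∀ x v, offBlock R θ (!b) b x v = 0) :
    IsPolarizedVariation (E := E) F (W b) (fun p x => W b x ⊓ H p x) h where
  subbundle := isSmoothSubbundle_of_projection hflat (hR.family.sm_weighted hflat _)
    (hR.blockProj_mem b) fun x u hu => hR.blockProj_of_mem hu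
  parallel x s hs v := hR.flatConn_mem hflat hV hθ h0 hs v
  hodge_subbundle p := hR.subbundle_inf hflat hV p b
  hodge_indep x := (hV.hodge_indep x).mono fun p => inf_le_right
  hodge_sum x := hR.graded b x fun p u => hV.hodgeProj_mem p x u
  transversal p x s hs v := by
    have hsW : IsSmoothSectionNear (E := E) F (W b) s x := hs.mono fun y hy => ⟨hy.1.1, hy.2⟩
    have hsH : IsSmoothSectionNear (E := E) F (H p) s x := hs.mono fun y hy => ⟨hy.1.2, hy.2⟩
    have h1 : ∀ v, flatConn F s x v ∈ W b x := hR.flatConn_mem hflat hV hθ h0 hsW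
    -- Gradedness puts the Hodge components of a vector of `W b` back in `W b`, so transversality in
    -- `V` restricts.
    have hinf : ∀ p q : ℤ, p ≠ q → ∀ u ∈ W b x, u ∈ H p x ⊔ H q x →
        u ∈ (W b x ⊓ H p x) ⊔ (W b x ⊓ H q x) := by
      intro p q hpq u hu hu'
      obtain ⟨y, hy, z, hz, rfl⟩ := Submodule.mem_sup.1 hu'
      have h2 := hR.hodgeProj_of_mem (p := p) hu
      have h3 := hR.hodgeProj_of_mem (p := q) hu
      rw [map_add, hV.hodgeProj_of_mem hy, hV.hodgeProj_of_mem_ne hpq.symm hz, add_zero] at h2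
      rw [map_add, hV.hodgeProj_of_mem hz, hV.hodgeProj_of_mem_ne hpq hy, zero_add] at h3
      refine Submodule.add_mem_sup ⟨?_, hy⟩ ⟨?_, hz⟩
      · rw [h2]; exact hR.proj_mem p b x _
      · rw [h3]; exact hR.proj_mem q b x _
    obtain ⟨h4, h5⟩ := hV.transversal p x s hsH v
    exact ⟨hinf _ _ (by omega) _ (Submodule.smul_mem _ _ (Submodule.sub_mem _ (h1 v)
      (Submodule.smul_mem _ _ (h1 _)))) h4, hinf _ _ (by omega) _ (Submodule.smul_mem _ _
      (Submodule.add_mem _ (h1 v) (Submodule.smul_mem _ _ (h1 _)))) h5⟩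
  hermitian x u _ t _ := hV.herm x u t
  form_smooth x s t hs ht := hV.form_smooth x s t hs.sm ht.sm
  form_flat x s t hs ht v := hV.form_flat x s t hs.sm ht.sm v
  orthogonal x p q hpq u hu t ht := hV.orthogonal x p q hpq u hu.2 t ht.2
  positive x p u hu hne := hV.positive x p u hu.2 hne

theorem IsHodgeRefinement.isPolarizedSplitting
    (h0 : ∀ x v, offBlock R θ false true x v = 0) (h0' : ∀ x v, offBlock R θ true false x v = 0) :
    IsPolarizedSplitting (E := E) F H h (W true) (W false) where
  left := hR.isPolarizedVariation hflat hV hθ h0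
  right := hR.isPolarizedVariation hflat hV hθ h0'
  isCompl x := by
    constructor
    · rw [Submodule.disjoint_def]
      intro u hu hu'
      refine hR.family.ext fun a => ?_
      rw [map_zero]
      obtain ⟨p, _ | _⟩ := a
      · exact (hR.mem true x u).1 hu p
      · exact (hR.mem false x u).1 hu' p
    · rw [codisjoint_iff, ← top_le_iff]
      intro u _
      rw [← hR.blockProj_add x u]
      exact Submodule.add_mem_sup (hR.blockProj_mem true x u) (hR.blockProj_mem false x u)
  hodge p x := by
    refine le_antisymm (sup_le inf_le_right inf_le_right) fun u hu => ?_
    rw [← hV.hodgeProj_of_mem hu, hR.hodge]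
    exact Submodule.add_mem_sup (hR.proj_mem_inf hflat hV p true x u)
      (hR.proj_mem_inf hflat hV p false x u)
  orthogonal x u hu t ht := by
    have h1 : blockProj R true x t = 0 := by
      refine hR.family.ext fun a => ?_
      rw [hR.proj_blockProj, map_zero]
      split_ifs with ha
      · have h2 : a = (a.1, !false) := Prod.ext rfl ha
        rw [h2, (hR.mem false x t).1 ht]
      · rfl
    rw [← hR.blockProj_of_mem hu, hR.blockProj_adj, h1, map_zero]

end Splitting

end

end CVHS

/-! ### Conclusion. -/

theorem corollary1p5
    {E : Type*} [NormedAddCommGroup E] [NormedSpace ℂ E] [FiniteDimensional ℂ E]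
    {M : Type*} [TopologicalSpace M] [ChartedSpace E M] [IsManifold 𝓘(ℂ, E) ω M]
    (F : Type*) [NormedAddCommGroup F] [NormedSpace ℂ F] [FiniteDimensional ℂ F]
    {V : M → Type*} [∀ x, AddCommGroup (V x)] [∀ x, Module ℂ (V x)]
    [∀ x, TopologicalSpace (V x)] [TopologicalSpace (TotalSpace F V)]
    [FiberBundle F V] [VectorBundle ℂ F V]
    (hflat : CVHS.IsLocalSystem F V)
    (H : ℤ → ∀ x, Submodule ℂ (V x)) (h : ∀ x, V x →ₗ[ℂ] V x →ₗ⋆[ℂ] ℂ)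
    (hV : CVHS.IsPolarizedVariation (E := E) F (fun _ => ⊤) H h)
    (W : ∀ x, Submodule ℂ (V x))
    (hW : CVHS.IsGradedHiggsSubbundle (E := E) F H W) :
    (∃! γ : M → E →ₗ[ℝ] E →ₗ[ℝ] ℂ, CVHS.IsFirstChernForm F H h W γ) ∧
    ∀ γ : M → E →ₗ[ℝ] E →ₗ[ℝ] ℂ, CVHS.IsFirstChernForm F H h W γ →
      CVHS.IsNegSemidefOneOneForm γ ∧
      ((∀ x, γ x = 0) ↔ CVHS.IsGradedHiggsSubbundle (E := E) F H (CVHS.perp H h W)) ∧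
      ((∀ x, γ x = 0) →
        CVHS.IsPolarizedSplitting (E := E) F H h W (CVHS.perp H h W)) := by
  have : IsManifold 𝓘(ℝ, E) ∞ M := CVHS.isManifold_real
  obtain ⟨R, hR⟩ := hV.exists_refinement hflat hW.graded hW.subbundle
  obtain ⟨θ, hθ, hskew⟩ := (hV.isFlatHermitian hflat).exists_offDiagonal hR.family hflat
  have hzero : ∀ γ : M → E →ₗ[ℝ] E →ₗ[ℝ] ℂ, CVHS.IsFirstChernForm F H h W γ →
      (∀ x, γ x = 0) → (∀ x v, CVHS.offBlock R θ false true x v = 0) ∧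
        ∀ x v, CVHS.offBlock R θ true false x v = 0 := by
    intro γ hγ h0
    have h1 : ∀ x v, CVHS.offBlock R θ false true x v = 0 := fun x v =>
      -- Only the vanishing of `γ(v, Jv)` is used: it is already minus a sum of squares that detects
      -- the second fundamental form.
      (hR.firstChernForm_properties hflat hV hθ hW hskew hγ x v v).2.2.2.2 (by simp [h0])
    exact ⟨h1, fun x v => hR.offBlock_swap_eq_zero hflat hV hskew (h1 x v)⟩
  refine ⟨?_, fun γ hγ => ⟨fun x v w => ?_, ⟨fun h0 => ?_, fun hW' x => ?_⟩, fun h0 => ?_⟩⟩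
  · obtain ⟨γ, hγ⟩ := hR.exists_isFirstChernForm hflat hV hW hθ
    refine ⟨γ, hγ, fun γ' hγ' => ?_⟩
    ext x v w
    rw [hR.firstChernForm_eq hflat hV hθ hW hγ, hR.firstChernForm_eq hflat hV hθ hW hγ']
  · obtain ⟨h1, h2, h3, h4, -⟩ := hR.firstChernForm_properties hflat hV hθ hW hskew hγ x v w
    exact ⟨h1, h2, h3, h4⟩
  · exact hR.isGradedHiggsSubbundle (b := false) hflat hV hθ (hzero γ hγ h0).2
  · have h1 := hR.offBlock_eq_zero hflat hV hθ hW hskew hW'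
    ext v w
    rw [hR.firstChernForm_eq hflat hV hθ hW hγ, h1, h1]
    simp
  · obtain ⟨h1, h2⟩ := hzero γ hγ h0
    exact hR.isPolarizedSplitting hflat hV hθ h1 h2
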